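/- **Setting.** Let $P,N>0$, let $n\ge 1$ be the block-length, $\mathcal X=\{x\in\mathbb R^n:\sum_t x_t^2\le nP\}$ and $\mathcal S=\{s\in\mathbb R^n:\sum_t s_t^2\le nN\}$. A (stochastic) code with $M$ equiprobable messages consists of a probability law $p_{\mathbf X|W=w}$ on $\mathcal X$ for each message $w\in\{1,\dots,M\}$ and of a randomized decoder $p_{V|\mathbf Y}$ from $\mathbb R^n$ to $\{1,\dots,M\}$; its rate is $R=\frac1n\log_2 M$. The jammer adds to the codeword $\mathbf X$ a noise $\mathbf S$ with a conditional law $p_{\mathbf S|\mathbf X}$ carried by $\mathcal S$ that is *causal*: for every $t$, the conditional law of $S_t$ given $\mathbf S_{<t}$ and $\mathbf X$ depends only on $\mathbf S_{<t}$ and $\mathbf X_{\le t}$. The receiver observes $\mathbf Y=\mathbf X+\mathbf S$. The average probability of error is $$\mathbb P_{\mathrm{Avg}}=\sup_{p_{\mathbf S|\mathbf X}\ \text{causal}}\ \frac1M\sum_{w=1}^M\Pr(V\neq w\mid W=w).$$ Let $$C_n=\sup_{\mathbf P}\ \inf_{\mathbf N}\ \min_{1\le m\le n}\ \frac1{2n}\sum_{t=1}^m\log_2\frac{P_t}{N_t},$$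 where the supremum is over $\mathbf P\in(0,\infty)^n$ with $\sum_{t=1}^nP_t=nP$, and the infimum and the minimum are over $\mathbf N\in(0,\infty)^n$ with $\sum_{t=1}^nN_t\le nN$ and $m\in\{1,\dots,n\}$ such that $N_t\le P_t$ for all $t\le m$ and $nP-\sum_{t=1}^mP_t\le 2nN-\sum_{t=1}^m2N_t$. **Theorem 1 (Converse).** Let $P,N>0$ and $\varepsilon>0$. There are a constant $c>0$ and an integer $n_0$, depending only on $P$, $N$ and $\varepsilon$, such that for every block-length $n\ge n_0$ every code of block-length $n$ (with signal power $P$) and rate $R\ge C_n+3\varepsilon$ satisfies $\mathbb P_{\mathrm{Avg}}\ge c\,\varepsilon$. -/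

import Mathlib

open MeasureTheory ProbabilityTheory
open scoped ENNReal

noncomputable section

namespace QuadCausal

/-- The signal ball `{x ∈ ℝⁿ : ∑ x_t² ≤ n P}` (also used, with `N` in place of `P`, for the noise). -/
def ball (n : ℕ) (P : ℝ) : Set (Fin n → ℝ) :=
  {x | ∑ t, x t ^ 2 ≤ n * P}

/-- A (possibly stochastic) code with `M` equiprobable messages, block-length `n` and signal power
`P`: for every message a probability law of the codeword, carried by the signal ball, and a
randomized decoding rule. A law may be a point mass, so deterministic codes are included. -/
structure Code (M n : ℕ) (P : ℝ) where
  /-- law of the transmitted codeword given the message -/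
  enc : Fin M → Measure (Fin n → ℝ)
  enc_prob : ∀ w, IsProbabilityMeasure (enc w)
  enc_power : ∀ w, ∀ᵐ x ∂(enc w), x ∈ ball n P
  /-- law of the estimated message given the received word -/
  dec : Kernel (Fin n → ℝ) (Fin M)
  dec_prob : IsMarkovKernel dec

/-- Causality of a conditional law `κ` of the noise `S` given the codeword `X`: for every time `t`
the conditional law of `S_t` given `S_{<t} = s_{<t}` and `X = x` is a function `K` of `s_{<t}` and
of `x_{≤ t}` only. -/
def IsCausal {n : ℕ} (P : ℝ) (κ : Kernel (Fin n → ℝ) (Fin n → ℝ)) : Prop :=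
  ∀ t : Fin n, ∃ K : Kernel ((Set.Iio t → ℝ) × (Set.Iic t → ℝ)) ℝ, IsMarkovKernel K ∧
    ∀ x ∈ ball n P,
      (κ x).map (fun s => ((Set.Iio t).domRestrict s, s t)) =
        ((κ x).map (fun s => (Set.Iio t).domRestrict s)) ⊗ₘ (K.sectL ((Set.Iic t).domRestrict x))

/-- The strategies of the jammer: causal conditional laws of the noise given the codeword, carried
by the noise ball `{s ∈ ℝⁿ : ∑ s_t² ≤ n N}`. -/
structure IsAdversary {n : ℕ} (P N : ℝ) (κ : Kernel (Fin n → ℝ) (Fin n → ℝ)) : Prop where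
  prob : IsMarkovKernel κ
  power : ∀ x ∈ ball n P, ∀ᵐ s ∂(κ x), s ∈ ball n N
  causal : IsCausal P κ

/-- The probability of a decoding error when message `w` is sent and the jammer uses `κ`;
the received word is `x + s`. -/
def errorProb {M n : ℕ} {P : ℝ} (c : Code M n P) (κ : Kernel (Fin n → ℝ) (Fin n → ℝ))
    (w : Fin M) : ℝ≥0∞ :=
  ∫⁻ x, ∫⁻ s, c.dec (x + s) {w}ᶜ ∂(κ x) ∂(c.enc w)

/-- The average probability of error: the supremum over all causal jammers of the error
probability averaged over the messages. -/
def avgError {M n : ℕ} {P : ℝ} (N : ℝ) (c : Code M n P) : ℝ≥0∞ :=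
  ⨆ (κ : Kernel (Fin n → ℝ) (Fin n → ℝ)) (_ : IsAdversary P N κ),
    (∑ w, errorProb c κ w) / M

/-- The rate `(1 / n) log₂ M` of a code. -/
def rate (M n : ℕ) : ℝ := Real.logb 2 M / n

/-- Power allocations of the transmitter: positive sequences that use the whole budget `n P`. -/
def signalPowers (n : ℕ) (P : ℝ) : Set (Fin n → ℝ) :=
  {p | (∀ t, 0 < p t) ∧ ∑ t, p t = n * P}

/-- Power allocations of the jammer: positive sequences of total power at most `n N`. -/
def noisePowers (n : ℕ) (N : ℝ) : Set (Fin n → ℝ) :=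
  {q | (∀ t, 0 < q t) ∧ ∑ t, q t ≤ n * N}

/-- The pairs (noise allocation `q`, division point `m`) that are feasible against the signal
allocation `p`: `q_t ≤ p_t` on the prefix `t ≤ m`, and the energy-bounding condition at `m`. -/
def feasible (n : ℕ) (P N : ℝ) (p : Fin n → ℝ) : Set ((Fin n → ℝ) × Fin n) :=
  {a | a.1 ∈ noisePowers n N ∧ (∀ t ≤ a.2, a.1 t ≤ p t) ∧
    n * P - ∑ t ∈ Finset.Iic a.2, p t ≤ 2 * n * N - ∑ t ∈ Finset.Iic a.2, 2 * a.1 t}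

/-- The optimal value `C_n` of the babble-push optimization,
`sup_p inf_q min_m (1 / 2n) ∑_{t ≤ m} log₂ (p_t / q_t)`. -/
def optValue (n : ℕ) (P N : ℝ) : EReal :=
  ⨆ p ∈ signalPowers n P, ⨅ a ∈ feasible n P N p,
    ((1 / (2 * n) * ∑ t ∈ Finset.Iic a.2, Real.logb 2 (p t / a.1 t) : ℝ) : EReal)

end QuadCausal

end

/-! The jammer babbles and then pushes. On an initial block `J` it acts as the test channel of
Gaussian rate-distortion theory, `y = (1 - a) x + √(a (1 - a) b) z`. Against a codeword of power
profile `b` this costs energy about `∑ a b` and reveals about `∑ log (1 / a) / 2` nats. It then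
draws a fake message and codeword from the posterior given `y`, and off `J` moves the signal to the
midpoint of the true and fake codewords. Given `y`, the true and fake pairs are exchangeable, and
the received word is symmetric in them. So whenever the two messages differ and both attacks are
affordable, the decoder errs for at least one of the two orders (`replica_confusion_le_avgError`).

Three things can spoil this. The babble may cost too much or reveal too much, which Chebyshev's
inequality makes rare (`babble_energy_tail`, `babble_info_tail`). The push may cost too much: its
mean energy is at most half the signal energy left off `J`, so Markov's inequality leaves a
probability of order `δ` when the budget has relative slack `δ` (`replica_push_le`). The messages
may coincide: a channel density below `Γ` with respect to a fixed law bounds this by about `Γ / M`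
(`replica_same_message_le`), exponentially small once the rate exceeds the leaked information. All
this is `avgError_ge_of_attack`.

The profile `b` must suit many codewords at once. Time is cut into `K` chunks, with `K` independent
of `n`, and chunk energies are rounded to a grid of mesh `η n`. By pigeonhole one cell carries a
mass `g` independent of `n` (`exists_chunkBall_mass`), and the jammer uses the posterior of the law
restricted to that cell. The profile, slightly shrunk, is a signal allocation; the definition of
`optValue` answers it with a noise allocation of value below `R - 2 ε`, which is rounded to chunks
to give the attack (`exists_chunk_noise`, `exists_chunk_attack`). Shrinking yields slack
proportional to the prefix energy. If that energy is negligible, pushing from the start is almost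
affordable, and babbling over one short chunk where the energy jumps saves the missing amount
(`exists_attack_of_jump`). -/

noncomputable section

namespace QuadCausal

/-! ### Concentration of Gaussian quadratic forms -/

/-- The standard Gaussian law on `ι → ℝ`. -/
def stdGaussian (ι : Type*) [Fintype ι] : Measure (ι → ℝ) :=
  Measure.pi fun _ => gaussianReal 0 1

instance (ι : Type*) [Fintype ι] : IsProbabilityMeasure (stdGaussian ι) := by
  unfold stdGaussian; infer_instance

/-- The variance of the square of a standard Gaussian variable. -/
def sqVariance : ℝ := Var[fun z : ℝ => z ^ 2; gaussianReal 0 1]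

theorem sqVariance_nonneg : 0 ≤ sqVariance := variance_nonneg _ _

theorem memLp_gaussian_id : MemLp (fun z : ℝ => z) 2 (gaussianReal 0 1) :=
  memLp_id_gaussianReal 2

theorem memLp_gaussian_sq : MemLp (fun z : ℝ => z ^ 2) 2 (gaussianReal 0 1) := by
  have h := (memLp_id_gaussianReal (μ := 0) (v := 1) 4)
  have h2 := h.norm_rpow_div 2
  have e : ((4 : NNReal) : ℝ≥0∞) / 2 = 2 := by
    have : (4 : ℝ≥0∞) = 2 * 2 := by norm_num
    rw [ENNReal.coe_ofNat, this]
    exact ENNReal.mul_div_cancel_right (by norm_num) (by norm_num)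
  rw [e] at h2
  simpa using h2

theorem variance_add_le {Ω : Type*} {mΩ : MeasurableSpace Ω} {μ : Measure Ω}
    [IsProbabilityMeasure μ] {X Y : Ω → ℝ} (hX : MemLp X 2 μ) (hY : MemLp Y 2 μ) :
    Var[fun ω => X ω + Y ω; μ] ≤ 2 * Var[X; μ] + 2 * Var[Y; μ] := by
  have h1 := variance_fun_add hX hY
  have h2 := variance_fun_sub hX hY
  have h3 : 0 ≤ Var[fun ω => X ω - Y ω; μ] := variance_nonneg _ _
  linarith

theorem integral_gaussian_sq : ∫ z, z ^ 2 ∂(gaussianReal 0 1) = 1 := by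
  have h := variance_eq_sub (memLp_gaussian_id)
  have h' : Var[fun z : ℝ => z; gaussianReal 0 1] = 1 := by
    simp
  have h'' : ∫ z, z ∂(gaussianReal 0 1) = 0 := integral_id_gaussianReal
  rw [h', h''] at h
  simpa using h.symm

/-- Chebyshev's inequality: the summands are independent and centred because `z ^ 2` has mean one.
Both the babble energy and the information density are, up to a constant, sums of this form. -/
theorem stdGaussian_quadratic_tail {ι : Type*} [Fintype ι] (β γ : ι → ℝ) {s : ℝ} (hs : 0 < s) :
    stdGaussian ι {z | s ≤ ∑ t, (β t * z t + γ t * (z t ^ 2 - 1))} ≤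
      ENNReal.ofReal ((∑ t, (2 * β t ^ 2 + 2 * sqVariance * γ t ^ 2)) / s ^ 2) := by
  have h1 : ∀ t, MemLp (fun z : ℝ => β t * z) 2 (gaussianReal 0 1) := fun t =>
    memLp_gaussian_id.const_mul _
  have h2 : ∀ t, MemLp (fun z : ℝ => γ t * (z ^ 2 - 1)) 2 (gaussianReal 0 1) := fun t =>
    (memLp_gaussian_sq.sub (memLp_const 1)).const_mul _
  have h3 : ∀ t, MemLp (fun z : ℝ => β t * z + γ t * (z ^ 2 - 1)) 2 (gaussianReal 0 1) :=
    fun t => (h1 t).add (h2 t)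
  have hv : ∀ t, Var[fun z : ℝ => β t * z + γ t * (z ^ 2 - 1); gaussianReal 0 1] ≤
      2 * β t ^ 2 + 2 * sqVariance * γ t ^ 2 := by
    intro t
    refine (variance_add_le (h1 t) (h2 t)).trans (le_of_eq ?_)
    rw [variance_const_mul, variance_const_mul,
      variance_sub_const memLp_gaussian_sq.aestronglyMeasurable]
    have h' : Var[fun z : ℝ => z; gaussianReal 0 1] = 1 := by
      simp
    rw [h', sqVariance]; ring
  have hm : ∀ t, ∫ z, (β t * z + γ t * (z ^ 2 - 1)) ∂(gaussianReal 0 1) = 0 := by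
    intro t
    have i1 : Integrable (fun z : ℝ => z) (gaussianReal 0 1) :=
      memLp_gaussian_id.integrable (by norm_num)
    have i2 : Integrable (fun z : ℝ => z ^ 2) (gaussianReal 0 1) :=
      memLp_gaussian_sq.integrable (by norm_num)
    rw [integral_add (i1.const_mul _) ((show Integrable (fun z : ℝ => z ^ 2 - 1) (gaussianReal 0 1) from
        i2.sub (integrable_const 1)).const_mul _),
      integral_const_mul, integral_const_mul, integral_sub i2 (integrable_const 1),
      integral_gaussian_sq]
    have h'' : ∫ z, z ∂(gaussianReal 0 1) = 0 := integral_id_gaussianReal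
    simp [h'']
  let X : ι → (ι → ℝ) → ℝ := fun t z => β t * z t + γ t * (z t ^ 2 - 1)
  have hX : ∀ t, MemLp (X t) 2 (stdGaussian ι) := fun t =>
    (h3 t).comp_measurePreserving (measurePreserving_eval _ t)
  have hXm : ∀ t, ∫ z, X t z ∂(stdGaussian ι) = 0 := by
    intro t
    have e := (measurePreserving_eval (fun _ : ι => gaussianReal 0 1) t).map_eq
    rw [← hm t, ← e, integral_map (measurable_pi_apply t).aemeasurable (by fun_prop)]
    rfl
  have hS : MemLp (fun z => ∑ t, X t z) 2 (stdGaussian ι) := memLp_finsetSum _ fun t _ => hX t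
  have hSm : ∫ z, ∑ t, X t z ∂(stdGaussian ι) = 0 := by
    rw [integral_finsetSum _ fun t _ => (hX t).integrable (by norm_num)]
    simp [hXm]
  have hSv : Var[fun z => ∑ t, X t z; stdGaussian ι] ≤
      ∑ t, (2 * β t ^ 2 + 2 * sqVariance * γ t ^ 2) := by
    have := variance_sum_pi h3
    have e : (fun z => ∑ t, X t z) = ∑ t, X t := by ext z; simp
    rw [e, stdGaussian]
    refine this.le.trans (Finset.sum_le_sum fun t _ => hv t)
  refine le_trans (measure_mono ?_) ((meas_ge_le_variance_div_sq hS hs).trans ?_)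
  · intro z hz
    simp only [Set.mem_ofPred_eq, hSm, sub_zero] at hz ⊢
    exact hz.trans (le_abs_self _)
  · exact ENNReal.ofReal_le_ofReal (by gcongr)

/-! ### Densities of Gaussian channels -/

theorem pi_withDensity {ι : Type*} [Fintype ι] {α : ι → Type*} [∀ i, MeasurableSpace (α i)]
    (μ : ∀ i, Measure (α i)) [∀ i, IsProbabilityMeasure (μ i)] (f : ∀ i, α i → ℝ≥0∞)
    (hf : ∀ i, Measurable (f i)) [∀ i, SigmaFinite ((μ i).withDensity (f i))] :
    Measure.pi (fun i => (μ i).withDensity (f i)) =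
      (Measure.pi μ).withDensity fun x => ∏ i, f i (x i) := by
  refine Measure.pi_eq fun s hs => ?_
  rw [withDensity_apply _ (MeasurableSet.univ_pi hs), ← lintegral_indicator (.univ_pi hs)]
  have hm : ∀ i, Measurable ((s i).indicator (f i)) := fun i => (hf i).indicator (hs i)
  have e : ((Set.univ.pi s).indicator fun x => ∏ i, f i (x i)) =
      fun x => ∏ i, (s i).indicator (f i) (x i) := by
    ext x
    by_cases h : x ∈ Set.univ.pi s
    · rw [Set.indicator_of_mem h]
      exact Finset.prod_congr rfl fun i _ => (Set.indicator_of_mem (h i trivial) _).symm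
    · rw [Set.indicator_of_notMem h]
      simp only [Set.mem_univ_pi, not_forall] at h
      obtain ⟨i, hi⟩ := h
      exact (Finset.prod_eq_zero (Finset.mem_univ i) (Set.indicator_of_notMem hi _)).symm
  rw [e, lintegral_prod_eq_prod_lintegral_of_indepFun Finset.univ
    (fun i (x : ∀ i, α i) => (s i).indicator (f i) (x i))
    (iIndepFun_pi fun i => (hm i).aemeasurable) (fun i => (hm i).comp (measurable_pi_apply i))]
  refine Finset.prod_congr rfl fun i _ => ?_
  rw [(measurePreserving_eval μ i).lintegral_comp (hm i), lintegral_indicator (hs i),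
    withDensity_apply _ (hs i)]

/-- Logarithm of the density of `N(m, σ²)` with respect to `N(0, v)`. -/
def logRatio (m σ v y : ℝ) : ℝ :=
  Real.log (v / σ ^ 2) / 2 + y ^ 2 / (2 * v) - (y - m) ^ 2 / (2 * σ ^ 2)

theorem measurable_logRatio (m σ v : ℝ) : Measurable (logRatio m σ v) := by
  unfold logRatio; fun_prop

theorem gaussianReal_eq_withDensity_logRatio {m σ v : ℝ} (hσ : 0 < σ) (hv : 0 < v) :
    gaussianReal m (σ ^ 2).toNNReal = (gaussianReal 0 v.toNNReal).withDensity
      fun y => ENNReal.ofReal (Real.exp (logRatio m σ v y)) := by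
  have hσ2 : (σ ^ 2).toNNReal ≠ 0 := by simp [hσ.ne']
  have hv2 : v.toNNReal ≠ 0 := by simpa using hv
  rw [gaussianReal_of_var_ne_zero _ hσ2, gaussianReal_of_var_ne_zero _ hv2,
    ← withDensity_mul _ (measurable_gaussianPDF _ _)
      ((measurable_logRatio m σ v).exp.ennreal_ofReal)]
  congr 1
  ext y
  simp only [Pi.mul_apply, gaussianPDF]
  rw [← ENNReal.ofReal_mul (gaussianPDFReal_nonneg _ _ _)]
  congr 1
  simp only [gaussianPDFReal, Real.coe_toNNReal _ hv.le, Real.coe_toNNReal _ (sq_nonneg σ),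
    logRatio, sub_zero]
  rw [Real.exp_sub, Real.exp_add, ← Real.log_sqrt (by positivity),
    Real.exp_log (by positivity)]
  have e1 : Real.exp (y ^ 2 / (2 * v)) = (Real.exp (-y ^ 2 / (2 * v)))⁻¹ := by
    rw [← Real.exp_neg]; congr 1; ring
  have e2 : √(v / σ ^ 2) = √(2 * Real.pi * v) / √(2 * Real.pi * σ ^ 2) := by
    rw [← Real.sqrt_div (by positivity)]
    congr 1
    field_simp
  have e3 : Real.exp (-(y - m) ^ 2 / (2 * σ ^ 2)) = (Real.exp ((y - m) ^ 2 / (2 * σ ^ 2)))⁻¹ := by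
    rw [← Real.exp_neg]; congr 1; ring
  rw [e1, e2, e3]
  have : √(2 * Real.pi * v) ≠ 0 := by positivity
  have : √(2 * Real.pi * σ ^ 2) ≠ 0 := by positivity
  field_simp

/-- The output law of the Gaussian channel `y_t = c_t x_t + σ_t z_t` at the input `x`. -/
def gaussianOut {ι : Type*} [Fintype ι] (c σ x : ι → ℝ) : Measure (ι → ℝ) :=
  (stdGaussian ι).map fun z t => c t * x t + σ t * z t

theorem gaussianOut_eq_pi {ι : Type*} [Fintype ι] (c σ x : ι → ℝ) :
    gaussianOut c σ x = Measure.pi fun t => gaussianReal (c t * x t) (σ t ^ 2).toNNReal := by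
  have key : ∀ t, (gaussianReal 0 1).map (fun z => c t * x t + σ t * z) =
      gaussianReal (c t * x t) (σ t ^ 2).toNNReal := by
    intro t
    have h := gaussianReal_map_const_mul (μ := 0) (v := 1) (σ t)
    have h2 := gaussianReal_map_const_add (μ := σ t * 0) (v := NNReal.mk (σ t ^ 2) (sq_nonneg _) * 1) (c t * x t)
    rw [← h, Measure.map_map (by fun_prop) (by fun_prop)] at h2
    have e : NNReal.mk (σ t ^ 2) (sq_nonneg _) * 1 = (σ t ^ 2).toNNReal := by
      rw [mul_one]; ext; simp [sq_nonneg]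
    simpa [Function.comp_def, e] using h2
  have : ∀ t, SigmaFinite ((gaussianReal 0 1).map (fun z => c t * x t + σ t * z)) := by
    intro t; rw [key]; infer_instance
  rw [gaussianOut, stdGaussian, Measure.pi_map_pi (f := fun t z => c t * x t + σ t * z)
    fun t => by fun_prop]
  simp_rw [key]

/-- A centred Gaussian product law: the comparison law of the channel output. -/
def refGaussian {ι : Type*} [Fintype ι] (v : ι → ℝ) : Measure (ι → ℝ) :=
  Measure.pi fun t => gaussianReal 0 (v t).toNNReal

instance {ι : Type*} [Fintype ι] (v : ι → ℝ) : IsProbabilityMeasure (refGaussian v) := by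
  unfold refGaussian; infer_instance

/-- The information density of the Gaussian channel with respect to `refGaussian v`. -/
def infoDensity {ι : Type*} [Fintype ι] (c σ v x y : ι → ℝ) : ℝ :=
  ∑ t, logRatio (c t * x t) (σ t) (v t) (y t)

theorem gaussianOut_eq_withDensity {ι : Type*} [Fintype ι] {c σ v : ι → ℝ} (x : ι → ℝ)
    (hσ : ∀ t, 0 < σ t) (hv : ∀ t, 0 < v t) :
    gaussianOut c σ x = (refGaussian v).withDensity
      fun y => ENNReal.ofReal (Real.exp (infoDensity c σ v x y)) := by
  rw [gaussianOut_eq_pi]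
  have key := fun t => gaussianReal_eq_withDensity_logRatio (m := c t * x t) (hσ t) (hv t)
  have : ∀ t, SigmaFinite ((gaussianReal 0 (v t).toNNReal).withDensity
      fun y => ENNReal.ofReal (Real.exp (logRatio (c t * x t) (σ t) (v t) y))) := by
    intro t; rw [← key]; infer_instance
  simp_rw [key]
  rw [pi_withDensity _ _ fun t => (measurable_logRatio _ _ _).exp.ennreal_ofReal, refGaussian]
  congr 1
  ext y
  rw [infoDensity, Real.exp_sum, ENNReal.ofReal_prod_of_nonneg fun _ _ => (Real.exp_pos _).le]

/-! ### Causality, energy clipping and the jammer -/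

/-- When the law of the noise up to `t` depends only on the codeword up to `t`, it is a kernel in
that prefix, and its disintegration along the past noise is the required conditional law. -/
theorem isCausal_of_prefix {n : ℕ} {P : ℝ} (κ : Kernel (Fin n → ℝ) (Fin n → ℝ))
    [IsMarkovKernel κ]
    (h : ∀ (t : Fin n) (x x' : Fin n → ℝ), (∀ r ≤ t, x r = x' r) →
      (κ x).map (fun s => ((Set.Iio t).domRestrict s, s t)) =
        (κ x').map (fun s => ((Set.Iio t).domRestrict s, s t))) :
    IsCausal P κ := by
  intro t
  let F : (Fin n → ℝ) → (Set.Iio t → ℝ) × ℝ := fun s => ((Set.Iio t).domRestrict s, s t)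
  have hF : Measurable F := by
    refine Measurable.prodMk ?_ (measurable_pi_apply t)
    exact measurable_pi_lambda _ fun r => measurable_pi_apply (r : Fin n)
  let e : (Set.Iic t → ℝ) → Fin n → ℝ := fun u r => if hr : r ≤ t then u ⟨r, hr⟩ else 0
  have he : Measurable e := by
    refine measurable_pi_lambda _ fun r => ?_
    -- A prefix is extended by zeros to a full word; by hypothesis the extension does not affect the
    -- law up to `t`.
    by_cases hr : r ≤ t
    · simpa [e, hr] using measurable_pi_apply _
    · simp [e, hr]
  let ν : Kernel (Set.Iic t → ℝ) ((Set.Iio t → ℝ) × ℝ) := (κ.comap e he).map F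
  have : IsMarkovKernel ν := Kernel.IsMarkovKernel.map _ hF
  refine ⟨ν.condKernel.comap Prod.swap measurable_swap, inferInstance, fun x _ => ?_⟩
  set u : Set.Iic t → ℝ := (Set.Iic t).domRestrict x with hu
  have h1 : (κ x).map F = ν u := by
    rw [Kernel.map_apply _ hF, Kernel.comap_apply]
    refine h t _ _ fun r hr => ?_
    simp [e, hr, hu, Set.domRestrict_apply]
  have h2 : (κ x).map (fun s => (Set.Iio t).domRestrict s) = ν.fst u := by
    rw [Kernel.fst_apply, ← h1, Measure.map_map measurable_fst hF]
    rfl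
  have h3 : (ν.condKernel.comap Prod.swap measurable_swap).sectL u = ν.condKernel.sectR u := by
    ext b : 1
    simp
  change (κ x).map F = _
  rw [h2, h3, h1]
  conv_lhs => rw [← ν.disintegrate ν.condKernel]
  exact Kernel.compProd_apply_eq_compProd_sectR _ _ u

theorem measurableSet_ball (n : ℕ) (P : ℝ) : MeasurableSet (ball n P) :=
  measurableSet_le (f := fun x : Fin n → ℝ => ∑ t, x t ^ 2) (by fun_prop) measurable_const

/-- Keep the noise symbols only as long as the total energy stays within `T`. -/
def clip {n : ℕ} (T : ℝ) (s : Fin n → ℝ) : Fin n → ℝ :=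
  fun t => if ∑ r ∈ Finset.Iic t, s r ^ 2 ≤ T then s t else 0

theorem measurable_clip {n : ℕ} (T : ℝ) : Measurable (clip (n := n) T) := by
  refine measurable_pi_lambda _ fun t => ?_
  refine Measurable.ite (measurableSet_le ?_ measurable_const) (measurable_pi_apply t)
    measurable_const
  fun_prop

theorem clip_congr {n : ℕ} {T : ℝ} {s s' : Fin n → ℝ} {t : Fin n} (h : ∀ r ≤ t, s r = s' r) :
    ∀ r ≤ t, clip T s r = clip T s' r := by
  intro r hr
  have : ∑ i ∈ Finset.Iic r, s i ^ 2 = ∑ i ∈ Finset.Iic r, s' i ^ 2 :=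
    Finset.sum_congr rfl fun i hi => by rw [h i ((Finset.mem_Iic.1 hi).trans hr)]
  simp only [clip, this, h r hr]

/-- All surviving times lie in the initial segment ending at the last survivor, whose total energy
is at most `T` by the survival test. -/
theorem sum_clip_sq_le {n : ℕ} {T : ℝ} (hT : 0 ≤ T) (s : Fin n → ℝ) :
    ∑ t, clip T s t ^ 2 ≤ T := by
  classical
  set A : Finset (Fin n) := Finset.univ.filter fun t => ∑ r ∈ Finset.Iic t, s r ^ 2 ≤ T with hA
  have e : ∑ t, clip T s t ^ 2 = ∑ t ∈ A, s t ^ 2 := by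
    rw [hA, Finset.sum_filter]
    refine Finset.sum_congr rfl fun t _ => ?_
    simp only [clip]
    split_ifs <;> simp
  rw [e]
  rcases A.eq_empty_or_nonempty with h0 | h0
  · simpa [h0] using hT
  · refine le_trans (Finset.sum_le_sum_of_subset_of_nonneg (t := Finset.Iic (A.max' h0)) ?_
      fun _ _ _ => sq_nonneg _) (Finset.mem_filter.1 (A.max'_mem h0)).2
    exact fun t ht => Finset.mem_Iic.2 (A.le_max' t ht)

theorem clip_eq_self {n : ℕ} {T : ℝ} {s : Fin n → ℝ} (h : ∑ t, s t ^ 2 ≤ T) : clip T s = s := by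
  ext t
  refine if_pos (le_trans ?_ h)
  exact Finset.sum_le_sum_of_subset_of_nonneg (Finset.subset_univ _) fun _ _ _ => sq_nonneg _

/-- The noise that turns the codeword `x` into `y` on `J` and into the midpoint of `x` and `x'`
off `J`. -/
def babblePush {n : ℕ} (J : Finset (Fin n)) (x y x' : Fin n → ℝ) : Fin n → ℝ :=
  fun t => if t ∈ J then y t - x t else (x' t - x t) / 2

theorem measurable_babblePush {n : ℕ} (J : Finset (Fin n)) :
    Measurable fun p : (Fin n → ℝ) × (Fin n → ℝ) × (Fin n → ℝ) =>
      babblePush J p.1 p.2.1 p.2.2 := by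
  refine measurable_pi_lambda _ fun t => ?_
  by_cases ht : t ∈ J
  · simp only [babblePush, ht, if_true]; fun_prop
  · simp only [babblePush, ht, if_false]; fun_prop

theorem measurable_clip_babblePush {n : ℕ} (J : Finset (Fin n)) (T : ℝ) :
    Measurable fun p : (Fin n → ℝ) × (Fin n → ℝ) × (Fin n → ℝ) =>
      clip T (babblePush J p.1 p.2.1 p.2.2) :=
  (measurable_clip T).comp (measurable_babblePush J)

theorem measurable_clip_babblePush_right {n : ℕ} (J : Finset (Fin n)) (T : ℝ) (x : Fin n → ℝ) :
    Measurable fun p : (Fin n → ℝ) × (Fin n → ℝ) => clip T (babblePush J x p.1 p.2) :=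
  (measurable_clip_babblePush J T).comp
    (g := fun p : (Fin n → ℝ) × (Fin n → ℝ) × (Fin n → ℝ) => clip T (babblePush J p.1 p.2.1 p.2.2))
    (f := fun p : (Fin n → ℝ) × (Fin n → ℝ) => (x, p)) (by fun_prop)

theorem measurable_clip_babblePush_mid {n : ℕ} (J : Finset (Fin n)) (T : ℝ) (x x' : Fin n → ℝ) :
    Measurable fun y : Fin n → ℝ => clip T (babblePush J x y x') :=
  (measurable_clip_babblePush_right J T x).comp
    (g := fun p : (Fin n → ℝ) × (Fin n → ℝ) => clip T (babblePush J x p.1 p.2))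
    (f := fun y : Fin n → ℝ => (y, x')) (by fun_prop)

theorem map_compProd_of_fst {α β γ : Type*} [MeasurableSpace α] [MeasurableSpace β]
    [MeasurableSpace γ] (μ : Measure α) [SFinite μ] (ρ : Kernel α β) [IsMarkovKernel ρ]
    {f : α × β → γ} {g : α → γ} (hg : Measurable g) (h : ∀ p, f p = g p.1) :
    (μ ⊗ₘ ρ).map f = μ.map g := by
  have e : f = g ∘ Prod.fst := funext h
  rw [e, ← Measure.map_map hg measurable_fst, ← Measure.fst, Measure.fst_compProd]

theorem babblePush_congr {n : ℕ} {J : Finset (Fin n)} {x y x' u v u' : Fin n → ℝ} {t : Fin n}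
    (hx : ∀ r ≤ t, x r = u r) (hy : ∀ r ≤ t, r ∈ J → y r = v r)
    (hx' : ∀ r ≤ t, r ∉ J → x' r = u' r) :
    ∀ r ≤ t, babblePush J x y x' r = babblePush J u v u' r := by
  intro r hr
  by_cases h : r ∈ J
  · simp [babblePush, h, hx r hr, hy r hr h]
  · simp [babblePush, h, hx r hr, hx' r hr h]

/-- The Gaussian channel `y_t = c_t x_t + σ_t z_t` as a kernel. -/
def gaussianChannel {n : ℕ} (c σ : Fin n → ℝ) : Kernel (Fin n → ℝ) (Fin n → ℝ) :=
  (Kernel.id ×ₖ Kernel.const _ (stdGaussian (Fin n))).map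
    fun p : (Fin n → ℝ) × (Fin n → ℝ) => fun t => c t * p.1 t + σ t * p.2 t

theorem gaussianChannel_apply {n : ℕ} (c σ x : Fin n → ℝ) :
    gaussianChannel c σ x = gaussianOut c σ x := by
  rw [gaussianChannel, Kernel.map_apply _ (by fun_prop), Kernel.prod_apply, Kernel.id_apply,
    Kernel.const_apply, Measure.dirac_prod, Measure.map_map (by fun_prop) (by fun_prop)]
  rfl

instance {n : ℕ} (c σ : Fin n → ℝ) : IsMarkovKernel (gaussianChannel c σ) :=
  Kernel.IsMarkovKernel.map _ (by fun_prop)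

/-- The babble-and-push jammer: on `J` it simulates the Gaussian channel, then it draws a fake
codeword from `ρ` given the simulated output and pushes towards the midpoint. -/
def jammer {n : ℕ} (J : Finset (Fin n)) (T : ℝ) (c σ : Fin n → ℝ)
    (ρ : Kernel (Fin n → ℝ) (Fin n → ℝ)) : Kernel (Fin n → ℝ) (Fin n → ℝ) :=
  (Kernel.id ×ₖ (gaussianChannel c σ ⊗ₖ ρ.prodMkLeft (Fin n → ℝ))).map
    fun p : (Fin n → ℝ) × (Fin n → ℝ) × (Fin n → ℝ) => clip T (babblePush J p.1 p.2.1 p.2.2)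

theorem jammer_apply {n : ℕ} (J : Finset (Fin n)) (T : ℝ) (c σ : Fin n → ℝ)
    (ρ : Kernel (Fin n → ℝ) (Fin n → ℝ)) [IsMarkovKernel ρ] (x : Fin n → ℝ) :
    jammer J T c σ ρ x = (gaussianOut c σ x ⊗ₘ ρ).map
      fun p => clip T (babblePush J x p.1 p.2) := by
  have hm := measurable_clip_babblePush J T
  have e : (gaussianChannel c σ ⊗ₖ ρ.prodMkLeft (Fin n → ℝ)) x = gaussianOut c σ x ⊗ₘ ρ := by
    rw [Kernel.compProd_apply_eq_compProd_sectR, gaussianChannel_apply]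
    congr 1
  rw [jammer, Kernel.map_apply _ hm, Kernel.prod_apply, Kernel.id_apply, e,
    Measure.dirac_prod, Measure.map_map hm (by fun_prop)]
  rfl

instance {n : ℕ} (c σ x : Fin n → ℝ) : IsProbabilityMeasure (gaussianOut c σ x) := by
  rw [← gaussianChannel_apply]; infer_instance

/-- Clipping enforces the energy bound and is causal. Inside `J` the noise uses the channel output
symbol by symbol and no fake codeword. Past `J` the fake codeword comes from an output that, the
gain being zero off `J`, depends on the codeword only through `J`, hence only on past symbols. -/
theorem isAdversary_jammer {n : ℕ} {P N : ℝ} (hN : 0 ≤ N) {J : Finset (Fin n)}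
    (hJ : ∀ s t, s ≤ t → t ∈ J → s ∈ J) {c σ : Fin n → ℝ} (hc : ∀ t ∉ J, c t = 0)
    (ρ : Kernel (Fin n → ℝ) (Fin n → ℝ)) [IsMarkovKernel ρ] :
    IsAdversary P N (jammer J (n * N) c σ ρ) := by
  have hmx := measurable_clip_babblePush_right J (n * N)
  have hM : IsMarkovKernel (jammer J (n * N) c σ ρ) := Kernel.IsMarkovKernel.map _ (measurable_clip_babblePush J (n * N))
  refine ⟨hM, fun x _ => ?_, isCausal_of_prefix _ fun t x x' hx => ?_⟩
  · rw [jammer_apply]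
    exact (ae_map_iff (p := fun s => s ∈ ball n N) (hmx x).aemeasurable (measurableSet_ball n N)).2
      (Filter.Eventually.of_forall fun p => sum_clip_sq_le (by positivity) _)
  obtain ⟨F, hFdef⟩ : ∃ F : (Fin n → ℝ) → (Set.Iio t → ℝ) × ℝ,
      F = fun s => ((Set.Iio t).domRestrict s, s t) := ⟨_, rfl⟩
  have hF : Measurable F := by
    rw [hFdef]
    refine Measurable.prodMk ?_ (measurable_pi_apply t)
    exact measurable_pi_lambda _ fun r => measurable_pi_apply (r : Fin n)
  have hFc : ∀ s s' : Fin n → ℝ, (∀ r ≤ t, s r = s' r) → F s = F s' := by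
    intro s s' h
    rw [hFdef]
    refine Prod.ext (funext fun r => h r (le_of_lt r.2)) (h t le_rfl)
  rw [← hFdef, jammer_apply, jammer_apply, Measure.map_map hF (hmx x), Measure.map_map hF (hmx x')]
  by_cases ht : t ∈ J
  -- Since `J` is an initial segment, the noise up to `t ∈ J` never involves the fake codeword,
  -- which may be replaced by `0`.
  · have hg : ∀ u : Fin n → ℝ, (gaussianOut c σ u ⊗ₘ ρ).map
        (F ∘ fun p => clip (n * N) (babblePush J u p.1 p.2)) =
        (stdGaussian (Fin n)).map ((F ∘ fun y => clip (n * N) (babblePush J u y 0)) ∘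
          fun z t => c t * u t + σ t * z t) := by
      intro u
      have hmu := hF.comp (measurable_clip_babblePush_mid J (n * N) u 0)
      rw [map_compProd_of_fst _ ρ hmu, gaussianOut, Measure.map_map hmu (by fun_prop)]
      intro p
      refine hFc _ _ (clip_congr (babblePush_congr (fun _ _ => rfl) (fun _ _ _ => rfl) ?_))
      exact fun r hr hrJ => absurd (hJ r t hr ht) hrJ
    rw [hg, hg]
    congr 1
    ext1 z
    refine hFc _ _ (clip_congr (babblePush_congr hx (fun r hr _ => ?_) fun _ _ _ => rfl))
    simp only [hx r hr]
  -- Here all of `J` precedes `t`, so two codewords agreeing up to `t` give the same law of the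
  -- whole simulated output.
  · have e : gaussianOut c σ x = gaussianOut c σ x' := by
      unfold gaussianOut
      congr 1
      ext z r
      by_cases hr : r ∈ J
      · have : r ≤ t := by
          by_contra hrt
          exact ht (hJ t r (not_le.1 hrt).le hr)
        rw [hx r this]
      · simp [hc r hr]
    rw [e]
    congr 1
    ext1 p
    exact hFc _ _ (clip_congr (babblePush_congr hx (fun _ _ _ => rfl) fun _ _ _ => rfl))

/-! ### Two independent draws from the posterior -/

section Replica

variable {Θ Y : Type*} [MeasurableSpace Θ] [MeasurableSpace Y] [StandardBorelSpace Θ] [Nonempty Θ]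

/-- The joint law of the observation and of two conditionally independent draws from the
posterior. -/
def replica (ν : Measure Θ) [IsFiniteMeasure ν] (κ : Kernel Θ Y) [IsMarkovKernel κ] :
    Measure (Y × Θ × Θ) :=
  (κ ∘ₘ ν) ⊗ₘ (posterior κ ν ×ₖ posterior κ ν)

variable (ν : Measure Θ) [IsFiniteMeasure ν] (κ : Kernel Θ Y) [IsMarkovKernel κ]

instance : IsFiniteMeasure (replica ν κ) := by unfold replica; infer_instance

theorem lintegral_replica_posterior {φ : Y × Θ × Θ → ℝ≥0∞} (hφ : Measurable φ) :
    ∫⁻ q, φ q ∂(replica ν κ) =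
      ∫⁻ y, ∫⁻ θ, ∫⁻ θ', φ (y, θ, θ') ∂(posterior κ ν y) ∂(posterior κ ν y) ∂(κ ∘ₘ ν) := by
  rw [replica, Measure.lintegral_compProd hφ]
  refine lintegral_congr fun y => ?_
  rw [Kernel.prod_apply, lintegral_prod _ (by fun_prop)]

/-- Bayes' rule: drawing the output and then the parameter from its posterior recovers the original
joint law. -/
theorem lintegral_posterior {f : Y × Θ → ℝ≥0∞} (hf : Measurable f) :
    ∫⁻ y, ∫⁻ θ, f (y, θ) ∂(posterior κ ν y) ∂(κ ∘ₘ ν) = ∫⁻ θ, ∫⁻ y, f (y, θ) ∂(κ θ) ∂ν := by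
  rw [← Measure.lintegral_compProd hf, compProd_posterior_eq_map_swap,
    lintegral_map hf measurable_swap, Measure.lintegral_compProd (by fun_prop)]
  rfl

theorem lintegral_replica {φ : Y × Θ × Θ → ℝ≥0∞} (hφ : Measurable φ) :
    ∫⁻ q, φ q ∂(replica ν κ) =
      ∫⁻ θ, ∫⁻ y, ∫⁻ θ', φ (y, θ, θ') ∂(posterior κ ν y) ∂(κ θ) ∂ν := by
  rw [lintegral_replica_posterior ν κ hφ]
  refine lintegral_posterior ν κ (f := fun p => ∫⁻ θ', φ (p.1, p.2, θ') ∂(posterior κ ν p.1)) ?_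
  have h : Measurable fun r : (Y × Θ) × Θ => φ (r.1.1, r.1.2, r.2) := by fun_prop
  exact h.lintegral_kernel_prod_right' (κ := (posterior κ ν).comap Prod.fst measurable_fst)

theorem lintegral_replica_swap {φ : Y × Θ × Θ → ℝ≥0∞} (hφ : Measurable φ) :
    ∫⁻ q, φ (q.1, q.2.2, q.2.1) ∂(replica ν κ) = ∫⁻ q, φ q ∂(replica ν κ) := by
  rw [lintegral_replica_posterior ν κ hφ, lintegral_replica_posterior ν κ (by fun_prop)]
  refine lintegral_congr fun y => ?_
  exact lintegral_lintegral_swap (by fun_prop)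

theorem replica_univ : replica ν κ Set.univ = ν Set.univ := by
  rw [← lintegral_one, lintegral_replica ν κ measurable_const]
  simp

/-- Observation and first draw have the joint law of channel output and true parameter, so a
conditional error bound integrates directly. -/
theorem replica_fst_le {B : Set (Y × Θ)} (hB : MeasurableSet B) {b : ℝ≥0∞}
    (h : ∀ᵐ θ ∂ν, κ θ {y | (y, θ) ∈ B} ≤ b) :
    replica ν κ {q | (q.1, q.2.1) ∈ B} ≤ b * ν Set.univ := by
  have hm : Measurable fun q : Y × Θ × Θ => (q.1, q.2.1) := by fun_prop
  have hmB : MeasurableSet {q : Y × Θ × Θ | (q.1, q.2.1) ∈ B} := hm hB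
  rw [← lintegral_indicator_one hmB, lintegral_replica ν κ (measurable_one.indicator hmB)]
  calc _ ≤ ∫⁻ θ, b ∂ν := lintegral_mono_ae ?_
    _ = _ := by simp
  filter_upwards [h] with θ hθ
  refine le_trans (le_of_eq ?_) hθ
  have hs : MeasurableSet {y | (y, θ) ∈ B} := measurable_prodMk_right hB
  rw [← lintegral_indicator_one hs]
  refine lintegral_congr fun y => ?_
  by_cases hy : (y, θ) ∈ B <;> simp [Set.indicator, hy]

theorem replica_swap {B : Set (Y × Θ × Θ)} (hB : MeasurableSet B) :
    replica ν κ {q | (q.1, q.2.2, q.2.1) ∈ B} = replica ν κ B := by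
  have hm : Measurable fun q : Y × Θ × Θ => (q.1, q.2.2, q.2.1) := by fun_prop
  have hmB : MeasurableSet {q : Y × Θ × Θ | (q.1, q.2.2, q.2.1) ∈ B} := hm hB
  rw [← lintegral_indicator_one hB, ← lintegral_replica_swap ν κ (measurable_one.indicator hB),
    ← lintegral_indicator_one hmB]
  rfl

theorem replica_snd_le {B : Set (Y × Θ)} (hB : MeasurableSet B) {b : ℝ≥0∞}
    (h : ∀ᵐ θ ∂ν, κ θ {y | (y, θ) ∈ B} ≤ b) :
    replica ν κ {q | (q.1, q.2.2) ∈ B} ≤ b * ν Set.univ := by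
  have hm : Measurable fun q : Y × Θ × Θ => (q.1, q.2.1) := by fun_prop
  exact (replica_swap ν κ (hm hB)).le.trans (replica_fst_le ν κ hB h)

/-- The squared distance of two independent copies is on average at most twice the second
moment. -/
theorem lintegral_sq_sub_le {Ω : Type*} [MeasurableSpace Ω] (μ : Measure Ω)
    [IsProbabilityMeasure μ] {f : Ω → ℝ} (hf : Measurable f) :
    ∫⁻ ω, ∫⁻ ω', ENNReal.ofReal ((f ω' - f ω) ^ 2) ∂μ ∂μ ≤
      2 * ∫⁻ ω, ENNReal.ofReal (f ω ^ 2) ∂μ := by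
  by_cases hfin : ∫⁻ ω, ENNReal.ofReal (f ω ^ 2) ∂μ = ∞
  · rw [hfin]; simp
  have hint2 : Integrable (fun ω => f ω ^ 2) μ := by
    refine (lintegral_ofReal_ne_top_iff_integrable (by fun_prop) ?_).1 hfin
    exact Filter.Eventually.of_forall fun _ => sq_nonneg _
  have hL : MemLp f 2 μ := (memLp_two_iff_integrable_sq hf.aestronglyMeasurable).2 hint2
  have hint1 : Integrable f μ := hL.integrable (by norm_num)
  have inner : ∀ ω, ∫⁻ ω', ENNReal.ofReal ((f ω' - f ω) ^ 2) ∂μ =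
      ENNReal.ofReal (∫ ω', f ω' ^ 2 ∂μ - 2 * f ω * ∫ ω', f ω' ∂μ + f ω ^ 2) := by
    intro ω
    have i1 : Integrable (fun ω' => f ω' ^ 2 - 2 * f ω * f ω') μ :=
      hint2.sub (hint1.const_mul _)
    have e : (fun ω' => (f ω' - f ω) ^ 2) = fun ω' => (f ω' ^ 2 - 2 * f ω * f ω') + f ω ^ 2 := by
      ext ω'; ring
    have i2 : Integrable (fun ω' => (f ω' - f ω) ^ 2) μ := by
      rw [e]; exact i1.add (integrable_const _)
    rw [← ofReal_integral_eq_lintegral_ofReal i2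
      (Filter.Eventually.of_forall fun _ => sq_nonneg _), e,
      integral_add i1 (integrable_const _), integral_sub hint2 (hint1.const_mul _),
      integral_const_mul]
    simp
  simp_rw [inner]
  -- The expression is the variance plus the square of `f ω` minus the mean.
  have hnn : ∀ ω, 0 ≤ ∫ ω', f ω' ^ 2 ∂μ - 2 * f ω * ∫ ω', f ω' ∂μ + f ω ^ 2 := by
    intro ω
    have h := variance_eq_sub hL
    have h' := variance_nonneg f μ
    have e : ∫ ω', (f ^ 2) ω' ∂μ = ∫ ω', f ω' ^ 2 ∂μ := rfl
    rw [h, e] at h'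
    nlinarith [sq_nonneg (f ω - ∫ ω', f ω' ∂μ)]
  have i1 : Integrable (fun ω => ∫ ω', f ω' ^ 2 ∂μ - 2 * f ω * ∫ ω', f ω' ∂μ) μ :=
    (integrable_const _).sub ((hint1.const_mul 2).mul_const _)
  have i3 : Integrable (fun ω => ∫ ω', f ω' ^ 2 ∂μ - 2 * f ω * ∫ ω', f ω' ∂μ + f ω ^ 2) μ :=
    i1.add hint2
  rw [← ofReal_integral_eq_lintegral_ofReal i3 (Filter.Eventually.of_forall hnn),
    ← ofReal_integral_eq_lintegral_ofReal hint2 (Filter.Eventually.of_forall fun _ => sq_nonneg _),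
    show (2 : ℝ≥0∞) = ENNReal.ofReal 2 by simp, ← ENNReal.ofReal_mul (by norm_num)]
  refine ENNReal.ofReal_le_ofReal ?_
  have e : ∫ ω, ((∫ ω', f ω' ^ 2 ∂μ - 2 * f ω * ∫ ω', f ω' ∂μ) + f ω ^ 2) ∂μ =
      2 * ∫ ω, f ω ^ 2 ∂μ - 2 * (∫ ω, f ω ∂μ) ^ 2 := by
    rw [integral_add i1 hint2, integral_sub (integrable_const _)
      ((hint1.const_mul 2).mul_const _), integral_mul_const, integral_const_mul]
    simp
    ring
  rw [e]
  nlinarith [sq_nonneg (∫ ω, f ω ∂μ)]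

/-- Conditionally on `y` the draws are independent with a common law; averaging the second moment of
the posterior over `y` returns the prior second moment. -/
theorem lintegral_replica_sq_sub_le {f : Θ → ℝ} (hf : Measurable f) :
    ∫⁻ q, ENNReal.ofReal ((f q.2.2 - f q.2.1) ^ 2) ∂(replica ν κ) ≤
      2 * ∫⁻ θ, ENNReal.ofReal (f θ ^ 2) ∂ν := by
  rw [lintegral_replica_posterior ν κ (by fun_prop)]
  calc _ ≤ ∫⁻ y, 2 * ∫⁻ θ, ENNReal.ofReal (f θ ^ 2) ∂(posterior κ ν y) ∂(κ ∘ₘ ν) :=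
        lintegral_mono fun y => lintegral_sq_sub_le _ hf
    _ = 2 * ∫⁻ y, ∫⁻ θ, ENNReal.ofReal (f θ ^ 2) ∂(posterior κ ν y) ∂(κ ∘ₘ ν) := by
        refine lintegral_const_mul _ ?_
        have h : Measurable fun θ => ENNReal.ofReal (f θ ^ 2) := by fun_prop
        exact h.lintegral_kernel
    _ = _ := by
        rw [lintegral_posterior ν κ (f := fun p => ENNReal.ofReal (f p.2 ^ 2)) (by fun_prop)]
        simp

end Replica

/-- Two independent posterior draws rarely carry the same message when the channel has a small
density with respect to a fixed law `Q`, except on a set of small probability. -/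
theorem replica_same_message_le {M : ℕ} {X Y : Type*} [MeasurableSpace X] [MeasurableSpace Y]
    [StandardBorelSpace X] [Nonempty (Fin M × X)] (ν : Measure (Fin M × X)) [IsFiniteMeasure ν]
    (κ : Kernel (Fin M × X) Y) [IsMarkovKernel κ] (Q : Measure Y) [IsProbabilityMeasure Q]
    {D : Y × (Fin M × X) → ℝ≥0∞} (hD : Measurable D)
    (hκ : ∀ θ, κ θ = Q.withDensity fun y => D (y, θ)) (Γ b m : ℝ≥0∞)
    (hb : ∀ᵐ θ ∂ν, κ θ {y | Γ < D (y, θ)} ≤ b) (hm : ∀ w, ν {θ | θ.1 = w} ≤ m) :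
    replica ν κ {q | q.2.1.1 = q.2.2.1} ≤ b * ν Set.univ + Γ * m := by
  have hA : MeasurableSet {p : Y × (Fin M × X) | Γ < D p} := measurableSet_lt measurable_const hD
  have hE : MeasurableSet {q : Y × (Fin M × X) × (Fin M × X) | q.2.1.1 = q.2.2.1} :=
    measurableSet_eq_fun (by fun_prop) (by fun_prop)
  have hA' : MeasurableSet {q : Y × (Fin M × X) × (Fin M × X) | D (q.1, q.2.1) ≤ Γ} :=
    measurableSet_le (hD.comp (by fun_prop)) measurable_const
  have hsub : {q : Y × (Fin M × X) × (Fin M × X) | q.2.1.1 = q.2.2.1} ⊆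
      {q | (q.1, q.2.1) ∈ {p : Y × (Fin M × X) | Γ < D p}} ∪
        ({q | q.2.1.1 = q.2.2.1} ∩ {q | D (q.1, q.2.1) ≤ Γ}) := by
    intro q hq
    by_cases h : Γ < D (q.1, q.2.1)
    · exact Or.inl h
    · exact Or.inr ⟨hq, not_lt.1 h⟩
  refine (measure_mono hsub).trans ((measure_union_le _ _).trans (add_le_add ?_ ?_))
  · exact replica_fst_le ν κ hA hb
  have hmw : ∀ w : Fin M, MeasurableSet {θ : Fin M × X | θ.1 = w} := fun w =>
    measurableSet_eq_fun measurable_fst measurable_const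
  let π := posterior κ ν
  have hπm : ∀ w, Measurable fun y => π y {θ | θ.1 = w} := fun w =>
    Kernel.measurable_coe _ (hmw w)
  have hπm' : Measurable fun p : Y × (Fin M × X) => π p.1 {θ | θ.1 = p.2.1} := by
    have h : MeasurableSet {r : (Y × (Fin M × X)) × (Fin M × X) | r.2.1 = r.1.2.1} :=
      measurableSet_eq_fun (by fun_prop) (by fun_prop)
    exact Kernel.measurable_kernel_prodMk_left
      (κ := π.comap (Prod.fst : Y × (Fin M × X) → Y) measurable_fst) h
  rw [← lintegral_indicator_one (hE.inter hA'),
    lintegral_replica ν κ (measurable_one.indicator (hE.inter hA'))]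
  -- Where the density is at most `Γ`, the channel law is replaced by `Γ • Q`. Under `Q` the output
  -- no longer depends on the true message, so a guess from any posterior is right with mass at most
  -- `m`.
  calc _ ≤ ∫⁻ θ, ∫⁻ y, Γ * π y {θ' | θ'.1 = θ.1} ∂Q ∂ν := ?_
    _ = Γ * ∫⁻ y, ∑ w, ν {θ | θ.1 = w} * π y {θ' | θ'.1 = w} ∂Q := ?_
    _ ≤ Γ * ∫⁻ y, m ∂Q := ?_
    _ = Γ * m := by simp
  · refine lintegral_mono fun θ => ?_
    have hDθ : Measurable fun y => D (y, θ) := hD.comp (by fun_prop)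
    have hin : ∀ y, ∫⁻ θ', ({q : Y × (Fin M × X) × (Fin M × X) | q.2.1.1 = q.2.2.1} ∩
        {q | D (q.1, q.2.1) ≤ Γ}).indicator 1 (y, θ, θ') ∂(π y) =
        {y | D (y, θ) ≤ Γ}.indicator (fun y => π y {θ' | θ'.1 = θ.1}) y := by
      intro y
      by_cases h : D (y, θ) ≤ Γ
      · rw [Set.indicator_of_mem (show y ∈ {y | D (y, θ) ≤ Γ} from h),
          ← lintegral_indicator_one (hmw _)]
        refine lintegral_congr fun θ' => ?_
        by_cases h2 : θ'.1 = θ.1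
        · simp [Set.indicator, h, h2]
        · simp [Set.indicator, h, h2, Ne.symm h2]
      · rw [Set.indicator_of_notMem (show y ∉ {y | D (y, θ) ≤ Γ} from h)]
        simp [Set.indicator, h]
    have hmy : Measurable fun y => {y | D (y, θ) ≤ Γ}.indicator
        (fun y => π y {θ' | θ'.1 = θ.1}) y :=
      (hπm θ.1).indicator (measurableSet_le hDθ measurable_const)
    change ∫⁻ y, ∫⁻ θ', _ ∂(π y) ∂(κ θ) ≤ _
    simp_rw [hin]
    rw [hκ, lintegral_withDensity_eq_lintegral_mul _ hDθ hmy]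
    refine lintegral_mono fun y => ?_
    by_cases h : D (y, θ) ≤ Γ
    · simp only [Pi.mul_apply, Set.indicator, Set.mem_ofPred_eq, h, if_true]
      gcongr
    · simp [Set.indicator, h]
  · have hmm : Measurable fun p : (Fin M × X) × Y => Γ * π p.2 {θ' | θ'.1 = p.1.1} :=
      (hπm'.comp measurable_swap).const_mul Γ
    rw [lintegral_lintegral_swap hmm.aemeasurable, ← lintegral_const_mul _ (by fun_prop)]
    refine lintegral_congr fun y => ?_
    have hmy : Measurable fun θ : Fin M × X => π y {θ' | θ'.1 = θ.1} :=
      hπm'.comp (measurable_prodMk_left (x := y))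
    rw [lintegral_const_mul _ hmy]
    congr 1
    have : ∀ θ : Fin M × X, π y {θ' | θ'.1 = θ.1} =
        ∑ w, {θ : Fin M × X | θ.1 = w}.indicator (fun _ => π y {θ' | θ'.1 = w}) θ := by
      intro θ
      rw [Finset.sum_eq_single θ.1]
      · simp
      · intro w _ hw
        simp [Set.indicator, hw.symm]
      · simp
    simp_rw [this]
    rw [lintegral_finsetSum _ fun w _ => measurable_const.indicator (hmw w)]
    refine Finset.sum_congr rfl fun w _ => ?_
    rw [lintegral_indicator_const (hmw w), mul_comm]
  · gcongr with y
    calc ∑ w, ν {θ | θ.1 = w} * π y {θ' | θ'.1 = w} ≤ ∑ w, m * π y {θ' | θ'.1 = w} := by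
          gcongr with w; exact hm w
      _ = m * π y Set.univ := by
          rw [← Finset.mul_sum, ← measure_biUnion_finset ?_ fun w _ => hmw w]
          · congr 2; ext θ; simp
          · intro w _ w' _ hww
            exact Set.disjoint_left.2 fun θ h1 h2 => hww (h1.symm.trans h2)
      _ = m := by simp

/-! ### Confusing the decoder by symmetry -/

/-- The joint law of the message and of the codeword. -/
def messageLaw {M n : ℕ} {P : ℝ} (C : Code M n P) : Measure (Fin M × (Fin n → ℝ)) :=
  (M : ℝ≥0∞)⁻¹ • ∑ w, (C.enc w).map (Prod.mk w)

theorem lintegral_messageLaw {M n : ℕ} {P : ℝ} (C : Code M n P)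
    (f : Fin M × (Fin n → ℝ) → ℝ≥0∞) :
    ∫⁻ θ, f θ ∂(messageLaw C) = (∑ w, ∫⁻ x, f (w, x) ∂(C.enc w)) / M := by
  rw [messageLaw, lintegral_smul_measure, lintegral_finsetSum_measure, smul_eq_mul, mul_comm,
    ENNReal.div_eq_inv_mul, mul_comm]
  congr 1
  exact Finset.sum_congr rfl fun w _ => (measurableEmbedding_prodMk_left w).lintegral_map _

theorem messageLaw_apply {M n : ℕ} {P : ℝ} (C : Code M n P) {A : Set (Fin M × (Fin n → ℝ))}
    (hA : MeasurableSet A) :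
    messageLaw C A = (∑ w, C.enc w {x | (w, x) ∈ A}) / M := by
  rw [← lintegral_indicator_one hA, lintegral_messageLaw]
  congr 1
  refine Finset.sum_congr rfl fun w _ => ?_
  have hs : MeasurableSet {x | (w, x) ∈ A} := measurable_prodMk_left hA
  rw [← lintegral_indicator_one hs]
  rfl

theorem messageLaw_univ {M n : ℕ} {P : ℝ} (C : Code M n P) (hM : M ≠ 0) :
    messageLaw C Set.univ = 1 := by
  have := C.enc_prob
  rw [messageLaw_apply C .univ]
  simp [ENNReal.div_self, hM]

theorem messageLaw_message_le {M n : ℕ} {P : ℝ} (C : Code M n P) (w : Fin M) :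
    messageLaw C {θ | θ.1 = w} ≤ (M : ℝ≥0∞)⁻¹ := by
  have := C.enc_prob
  have hs : MeasurableSet {θ : Fin M × (Fin n → ℝ) | θ.1 = w} :=
    measurableSet_eq_fun measurable_fst measurable_const
  rw [messageLaw_apply C hs, ENNReal.div_eq_inv_mul]
  refine mul_le_of_le_one_right' ?_
  rw [Finset.sum_eq_single w]
  · exact prob_le_one
  · intro w' _ hw
    simp [hw]
  · simp

theorem isFiniteMeasure_messageLaw {M n : ℕ} {P : ℝ} (C : Code M n P) (hM : M ≠ 0) :
    IsFiniteMeasure (messageLaw C) :=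
  ⟨by rw [messageLaw_univ C hM]; exact ENNReal.one_lt_top⟩

theorem ae_messageLaw_ball {M n : ℕ} {P : ℝ} (C : Code M n P) :
    ∀ᵐ θ ∂(messageLaw C), θ.2 ∈ ball n P := by
  have hs : MeasurableSet {θ : Fin M × (Fin n → ℝ) | ¬ θ.2 ∈ ball n P} :=
    (measurable_snd (measurableSet_ball n P)).compl
  rw [ae_iff, messageLaw_apply C hs]
  have h : ∑ w, C.enc w {x | (w, x) ∈ {θ : Fin M × (Fin n → ℝ) | ¬ θ.2 ∈ ball n P}} = 0 :=
    Finset.sum_eq_zero fun w _ => ae_iff.1 (C.enc_power w)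
  rw [h, ENNReal.zero_div]

/-- The Gaussian channel, seen as a channel from (message, codeword) pairs. -/
def pairChannel (M : ℕ) {n : ℕ} (c σ : Fin n → ℝ) :
    Kernel (Fin M × (Fin n → ℝ)) (Fin n → ℝ) :=
  (gaussianChannel c σ).comap Prod.snd measurable_snd

instance (M : ℕ) {n : ℕ} (c σ : Fin n → ℝ) : IsMarkovKernel (pairChannel M c σ) := by
  unfold pairChannel; infer_instance

theorem pairChannel_apply {M n : ℕ} (c σ : Fin n → ℝ) (θ : Fin M × (Fin n → ℝ)) :
    pairChannel M c σ θ = gaussianOut c σ θ.2 := by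
  rw [pairChannel, Kernel.comap_apply, gaussianChannel_apply]

/-- The received word under an unclipped babble-and-push attack. -/
def received {n : ℕ} (J : Finset (Fin n)) (x y x' : Fin n → ℝ) : Fin n → ℝ :=
  fun t => if t ∈ J then y t else (x t + x' t) / 2

theorem add_babblePush {n : ℕ} (J : Finset (Fin n)) (x y x' : Fin n → ℝ) :
    x + babblePush J x y x' = received J x y x' := by
  ext t
  by_cases h : t ∈ J
  · simp [received, babblePush, h]
  · simp only [received, babblePush, h, if_false, Pi.add_apply]; ring

theorem received_swap {n : ℕ} (J : Finset (Fin n)) (x y x' : Fin n → ℝ) :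
    received J x' y x = received J x y x' := by
  ext t
  simp [received, add_comm]

theorem measurable_received {n : ℕ} (J : Finset (Fin n)) :
    Measurable fun p : (Fin n → ℝ) × (Fin n → ℝ) × (Fin n → ℝ) =>
      received J p.1 p.2.1 p.2.2 := by
  refine measurable_pi_lambda _ fun t => ?_
  by_cases ht : t ∈ J
  · simp only [received, ht, if_true]; fun_prop
  · simp only [received, ht, if_false]; fun_prop

/-- The energy spent by the babble-and-push attack. -/
def attackEnergy {n : ℕ} (J : Finset (Fin n)) (x y x' : Fin n → ℝ) : ℝ :=
  ∑ t, babblePush J x y x' t ^ 2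

theorem measurable_attackEnergy {n : ℕ} (J : Finset (Fin n)) :
    Measurable fun p : (Fin n → ℝ) × (Fin n → ℝ) × (Fin n → ℝ) =>
      attackEnergy J p.1 p.2.1 p.2.2 := by
  have h := measurable_babblePush J
  unfold attackEnergy
  exact Finset.measurable_sum _ fun t _ => ((measurable_pi_apply t).comp h).pow_const 2

/-- The event that the attack confuses two different messages within the energy budget `T`. -/
def confusion (M : ℕ) {n : ℕ} (J : Finset (Fin n)) (T : ℝ) :
    Set ((Fin n → ℝ) × (Fin M × (Fin n → ℝ)) × (Fin M × (Fin n → ℝ))) :=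
  {q | attackEnergy J q.2.1.2 q.1 q.2.2.2 ≤ T ∧ attackEnergy J q.2.2.2 q.1 q.2.1.2 ≤ T ∧
    q.2.1.1 ≠ q.2.2.1}

theorem measurableSet_confusion (M : ℕ) {n : ℕ} (J : Finset (Fin n)) (T : ℝ) :
    MeasurableSet (confusion M J T) := by
  have h := measurable_attackEnergy J
  have h1 : Measurable fun q : (Fin n → ℝ) × (Fin M × (Fin n → ℝ)) × (Fin M × (Fin n → ℝ)) =>
      attackEnergy J q.2.1.2 q.1 q.2.2.2 :=
    h.comp (f := fun q : (Fin n → ℝ) × (Fin M × (Fin n → ℝ)) × (Fin M × (Fin n → ℝ)) =>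
      (q.2.1.2, q.1, q.2.2.2)) (by fun_prop)
  have h2 : Measurable fun q : (Fin n → ℝ) × (Fin M × (Fin n → ℝ)) × (Fin M × (Fin n → ℝ)) =>
      attackEnergy J q.2.2.2 q.1 q.2.1.2 :=
    h.comp (f := fun q : (Fin n → ℝ) × (Fin M × (Fin n → ℝ)) × (Fin M × (Fin n → ℝ)) =>
      (q.2.2.2, q.1, q.2.1.2)) (by fun_prop)
  have h3 : MeasurableSet
      {q : (Fin n → ℝ) × (Fin M × (Fin n → ℝ)) × (Fin M × (Fin n → ℝ)) | q.2.1.1 = q.2.2.1} :=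
    measurableSet_eq_fun (by fun_prop) (by fun_prop)
  exact (measurableSet_le h1 measurable_const).inter
    ((measurableSet_le h2 measurable_const).inter h3.compl)

theorem confusion_swap {M n : ℕ} {J : Finset (Fin n)} {T : ℝ}
    (q : (Fin n → ℝ) × (Fin M × (Fin n → ℝ)) × (Fin M × (Fin n → ℝ))) :
    (q.1, q.2.2, q.2.1) ∈ confusion M J T ↔ q ∈ confusion M J T := by
  simp only [confusion, Set.mem_ofPred_eq]
  constructor <;> exact fun h => ⟨h.2.1, h.1, h.2.2.symm⟩

theorem measurable_dec {M n : ℕ} {P : ℝ} (C : Code M n P) :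
    Measurable fun p : (Fin n → ℝ) × Fin M => C.dec p.1 {p.2}ᶜ :=
  measurable_from_prod_countable_left fun w => Kernel.measurable_coe _ (measurableSet_singleton w).compl

/-- On the confusion event clipping is inactive and the received word is unchanged when the two
draws are exchanged. The error events for the two distinct messages then cover everything, and the
exchange preserves the replica law; this gives the factor two. Working with a smaller law `ν` is
harmless, as the true error integral dominates the one over `ν`. -/
theorem replica_confusion_le_avgError {M n : ℕ} {P N : ℝ} (hN : 0 ≤ N) (C : Code M n P)
    {J : Finset (Fin n)} (hJ : ∀ s t, s ≤ t → t ∈ J → s ∈ J) {c σ : Fin n → ℝ}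
    (hc : ∀ t ∉ J, c t = 0) (ν : Measure (Fin M × (Fin n → ℝ))) [IsFiniteMeasure ν]
    [Nonempty (Fin M × (Fin n → ℝ))] (hν : ν ≤ messageLaw C) :
    replica ν (pairChannel M c σ) (confusion M J (n * N)) ≤ 2 * avgError N C := by
  have := C.dec_prob
  set T : ℝ := n * N with hT
  set κ := pairChannel M c σ with hκ
  set π := posterior κ ν with hπ
  -- The posterior draw includes a message, but the noise needs only the codeword, hence the second
  -- marginal.
  set jam := jammer J T c σ π.snd with hjam
  set 𝒢 := confusion M J T with h𝒢
  have h𝒢m : MeasurableSet 𝒢 := measurableSet_confusion M J T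
  have hadv : IsAdversary P N jam := isAdversary_jammer hN hJ hc _
  have hrecm : Measurable fun q : (Fin n → ℝ) × (Fin M × (Fin n → ℝ)) × (Fin M × (Fin n → ℝ)) =>
      received J q.2.1.2 q.1 q.2.2.2 :=
    (measurable_received J).comp
      (f := fun q : (Fin n → ℝ) × (Fin M × (Fin n → ℝ)) × (Fin M × (Fin n → ℝ)) =>
      (q.2.1.2, q.1, q.2.2.2)) (by fun_prop)
  let D : (Fin n → ℝ) × (Fin M × (Fin n → ℝ)) × (Fin M × (Fin n → ℝ)) → ℝ≥0∞ :=
    fun q => C.dec (received J q.2.1.2 q.1 q.2.2.2) {q.2.1.1}ᶜ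
  have hD : Measurable D :=
    (measurable_dec C).comp (f := fun q : (Fin n → ℝ) × (Fin M × (Fin n → ℝ)) ×
      (Fin M × (Fin n → ℝ)) => (received J q.2.1.2 q.1 q.2.2.2, q.2.1.1))
      (hrecm.prodMk (by fun_prop))
  let φ : (Fin n → ℝ) × (Fin M × (Fin n → ℝ)) × (Fin M × (Fin n → ℝ)) → ℝ≥0∞ :=
    𝒢.indicator D
  have hφ : Measurable φ := hD.indicator h𝒢m
  have h1 : ∫⁻ q, φ q ∂(replica ν κ) ≤ avgError N C := by
    calc ∫⁻ q, φ q ∂(replica ν κ)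
        ≤ ∫⁻ θ, ∫⁻ s, C.dec (θ.2 + s) {θ.1}ᶜ ∂(jam θ.2) ∂ν := ?_
      _ ≤ ∫⁻ θ, ∫⁻ s, C.dec (θ.2 + s) {θ.1}ᶜ ∂(jam θ.2) ∂(messageLaw C) :=
          lintegral_mono' hν le_rfl
      _ = (∑ w, errorProb C jam w) / M := lintegral_messageLaw C _
      _ ≤ avgError N C := le_iSup₂_of_le jam hadv le_rfl
    rw [lintegral_replica ν κ hφ]
    refine lintegral_mono fun θ => ?_
    have hd : Measurable fun s : Fin n → ℝ => C.dec (θ.2 + s) {θ.1}ᶜ :=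
      (Kernel.measurable_coe C.dec (measurableSet_singleton θ.1).compl).comp
        (f := fun s : Fin n → ℝ => θ.2 + s) (by fun_prop)
    have hcl := measurable_clip_babblePush_right J T θ.2
    have hdc : Measurable fun p : (Fin n → ℝ) × (Fin n → ℝ) =>
        C.dec (θ.2 + clip T (babblePush J θ.2 p.1 p.2)) {θ.1}ᶜ := hd.comp hcl
    rw [hjam, jammer_apply, lintegral_map hd hcl, Measure.lintegral_compProd hdc,
      ← pairChannel_apply (M := M)]
    refine lintegral_mono fun y => ?_
    have hdy : Measurable fun x' : Fin n → ℝ =>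
        C.dec (θ.2 + clip T (babblePush J θ.2 y x')) {θ.1}ᶜ :=
      hdc.comp (g := fun p : (Fin n → ℝ) × (Fin n → ℝ) =>
        C.dec (θ.2 + clip T (babblePush J θ.2 p.1 p.2)) {θ.1}ᶜ) (f := fun x' => (y, x'))
        (by fun_prop)
    rw [Kernel.snd_apply, lintegral_map hdy measurable_snd]
    refine lintegral_mono fun θ' => ?_
    by_cases hq : (y, θ, θ') ∈ 𝒢
    · have hE : ∑ t, babblePush J θ.2 y θ'.2 t ^ 2 ≤ T := hq.1
      have e : θ.2 + clip T (babblePush J θ.2 y θ'.2) = received J θ.2 y θ'.2 := by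
        rw [clip_eq_self hE, add_babblePush]
      rw [e]
      exact (Set.indicator_of_mem hq D).le
    · simp only [φ, Set.indicator_of_notMem hq]
      exact zero_le
  have h2 := lintegral_replica_swap ν κ hφ
  calc replica ν κ 𝒢 = ∫⁻ q, 𝒢.indicator 1 q ∂(replica ν κ) :=
        (lintegral_indicator_one h𝒢m).symm
    _ ≤ ∫⁻ q, (φ q + φ (q.1, q.2.2, q.2.1)) ∂(replica ν κ) := by
        refine lintegral_mono fun q => ?_
        by_cases hq : q ∈ 𝒢
        · have hq' := (confusion_swap (M := M) (J := J) (T := T) q).2 hq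
          have e : φ (q.1, q.2.2, q.2.1) =
              C.dec (received J q.2.1.2 q.1 q.2.2.2) {q.2.2.1}ᶜ := by
            rw [← received_swap]
            exact Set.indicator_of_mem hq' D
          rw [e]
          simp only [φ, Set.indicator_of_mem hq, D, Pi.one_apply]
          set u := received J q.2.1.2 q.1 q.2.2.2
          calc (1 : ℝ≥0∞) = C.dec u Set.univ := (measure_univ).symm
            _ ≤ C.dec u ({q.2.1.1}ᶜ ∪ {q.2.2.1}ᶜ) := by
                refine measure_mono fun w _ => ?_
                by_cases hw : w = q.2.1.1
                · exact Or.inr fun h => hq.2.2 (hw.symm.trans h)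
                · exact Or.inl hw
            _ ≤ _ := measure_union_le _ _
        · simp [Set.indicator_of_notMem hq]
    _ = ∫⁻ q, φ q ∂(replica ν κ) + ∫⁻ q, φ (q.1, q.2.2, q.2.1) ∂(replica ν κ) :=
        lintegral_add_left hφ _
    _ = 2 * ∫⁻ q, φ q ∂(replica ν κ) := by rw [h2, two_mul]
    _ ≤ 2 * avgError N C := by gcongr

/-! ### Energy and information of babbling -/

section Babble

/-- The gain of the babbling channel: `1 - a_t` on `J` and `0` off `J`. -/
def babbleGain {n : ℕ} (J : Finset (Fin n)) (a : Fin n → ℝ) : Fin n → ℝ :=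
  fun t => if t ∈ J then 1 - a t else 0

/-- The noise level of the babbling channel. -/
def babbleScale {n : ℕ} (J : Finset (Fin n)) (a b : Fin n → ℝ) : Fin n → ℝ :=
  fun t => if t ∈ J then √(a t * (1 - a t) * b t) else 1

/-- The output variance of the babbling channel for an input of variance `b_t`. -/
def babbleVar {n : ℕ} (J : Finset (Fin n)) (a b : Fin n → ℝ) : Fin n → ℝ :=
  fun t => if t ∈ J then (1 - a t) * b t else 1

variable {n : ℕ} {J : Finset (Fin n)} {a b : Fin n → ℝ}

theorem babbleScale_sq (ha : ∀ t ∈ J, 0 < a t ∧ a t < 1) (hb : ∀ t ∈ J, 0 < b t) {t : Fin n}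
    (ht : t ∈ J) : babbleScale J a b t ^ 2 = a t * (1 - a t) * b t := by
  have h1 := ha t ht
  have h2 := hb t ht
  have h3 : 0 < 1 - a t := by linarith
  rw [babbleScale, if_pos ht, Real.sq_sqrt (by have := h1.1; positivity)]

theorem babbleScale_pos (ha : ∀ t ∈ J, 0 < a t ∧ a t < 1) (hb : ∀ t ∈ J, 0 < b t) (t : Fin n) :
    0 < babbleScale J a b t := by
  unfold babbleScale
  split_ifs with ht
  · have h1 := ha t ht
    have h2 := hb t ht
    have h3 : 0 < 1 - a t := by linarith
    have := h1.1
    positivity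
  · exact one_pos

theorem babbleVar_pos (ha : ∀ t ∈ J, 0 < a t ∧ a t < 1) (hb : ∀ t ∈ J, 0 < b t) (t : Fin n) :
    0 < babbleVar J a b t := by
  unfold babbleVar
  split_ifs with ht
  · have h1 := ha t ht
    have h2 := hb t ht
    have h3 : 0 < 1 - a t := by linarith
    positivity
  · exact one_pos

theorem gaussianOut_tail_le {c σ x : Fin n → ℝ} {f : (Fin n → ℝ) → ℝ} (hf : Measurable f)
    {u s V : ℝ} (hs : 0 < s) (β γ : Fin n → ℝ)
    (h : ∀ z : Fin n → ℝ, f (fun t => c t * x t + σ t * z t) ≤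
      u + ∑ t, (β t * z t + γ t * (z t ^ 2 - 1)))
    (hV : ∑ t, (2 * β t ^ 2 + 2 * sqVariance * γ t ^ 2) ≤ V) :
    gaussianOut c σ x {y | u + s < f y} ≤ ENNReal.ofReal (V / s ^ 2) := by
  have hm : MeasurableSet {y | u + s < f y} := measurableSet_lt measurable_const hf
  rw [gaussianOut, Measure.map_apply (by fun_prop) hm]
  refine le_trans (measure_mono fun z hz => ?_) ((stdGaussian_quadratic_tail β γ hs).trans
    (ENNReal.ofReal_le_ofReal (by gcongr)))
  have h1 : u + s < f (fun t => c t * x t + σ t * z t) := hz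
  have h2 := h z
  simp only [Set.mem_ofPred_eq]
  linarith

/-- The noise is `-a x + σ z`. Its squared norm has mean `∑ (a² x² + a (1 - a) b)`, at most `∑ a b`
for codewords satisfying `hE`. The rest is a centred quadratic form in `z`, with variance of order
`n`. -/
theorem babble_energy_tail (ha : ∀ t ∈ J, 0 < a t ∧ a t < 1) (hb : ∀ t ∈ J, 0 < b t)
    {x : Fin n → ℝ} {P A s : ℝ} (hs : 0 < s) (hA : ∀ t ∈ J, a t * (1 - a t) * b t ≤ A)
    (hA0 : 0 ≤ A) (hx : x ∈ ball n P)
    (hE : ∑ t ∈ J, a t ^ 2 * x t ^ 2 ≤ ∑ t ∈ J, a t ^ 2 * b t) :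
    gaussianOut (babbleGain J a) (babbleScale J a b) x
      {y | ∑ t ∈ J, a t * b t + s < ∑ t ∈ J, (y t - x t) ^ 2} ≤
      ENNReal.ofReal (n * (8 * A * P + 2 * sqVariance * A ^ 2) / s ^ 2) := by
  set σ := babbleScale J a b with hσ
  have hσ2 : ∀ t ∈ J, σ t ^ 2 = a t * (1 - a t) * b t := fun t ht => babbleScale_sq ha hb ht
  refine gaussianOut_tail_le (by fun_prop) hs (fun t => if t ∈ J then -2 * a t * σ t * x t else 0)
    (fun t => if t ∈ J then σ t ^ 2 else 0) (fun z => ?_) ?_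
  · have e1 : ∑ t, ((if t ∈ J then -2 * a t * σ t * x t else 0) * z t +
        (if t ∈ J then σ t ^ 2 else 0) * (z t ^ 2 - 1)) =
        ∑ t ∈ J, (-2 * a t * σ t * x t * z t + σ t ^ 2 * (z t ^ 2 - 1)) := by
      rw [← Finset.sum_filter_add_sum_filter_not Finset.univ (fun t => t ∈ J)]
      rw [Finset.sum_eq_zero (s := Finset.univ.filter fun t => t ∉ J)]
      · rw [add_zero, Finset.filter_univ_mem]
        exact Finset.sum_congr rfl fun t ht => by simp [ht]
      · intro t ht
        simp [(Finset.mem_filter.1 ht).2]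
    rw [e1]
    have e2 : ∑ t ∈ J, (babbleGain J a t * x t + σ t * z t - x t) ^ 2 =
        ∑ t ∈ J, a t ^ 2 * x t ^ 2 + ∑ t ∈ J, a t * (1 - a t) * b t +
        ∑ t ∈ J, (-2 * a t * σ t * x t * z t + σ t ^ 2 * (z t ^ 2 - 1)) := by
      rw [← Finset.sum_add_distrib, ← Finset.sum_add_distrib]
      refine Finset.sum_congr rfl fun t ht => ?_
      rw [← hσ2 t ht, babbleGain, if_pos ht]
      ring
    have e3 : ∑ t ∈ J, a t ^ 2 * b t + ∑ t ∈ J, a t * (1 - a t) * b t = ∑ t ∈ J, a t * b t := by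
      rw [← Finset.sum_add_distrib]
      exact Finset.sum_congr rfl fun t _ => by ring
    rw [e2]
    linarith
  · have hq := sqVariance_nonneg
    calc ∑ t, (2 * (if t ∈ J then -2 * a t * σ t * x t else 0) ^ 2 +
          2 * sqVariance * (if t ∈ J then σ t ^ 2 else 0) ^ 2)
        ≤ ∑ t, (8 * A * x t ^ 2 + 2 * sqVariance * A ^ 2) := by
          refine Finset.sum_le_sum fun t _ => ?_
          split_ifs with ht
          · have h1 := ha t ht
            have h2 : σ t ^ 2 ≤ A := (hσ2 t ht).le.trans (hA t ht)
            have h3 : a t ^ 2 ≤ 1 := by nlinarith [h1.1, h1.2]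
            have h4 : (-2 * a t * σ t * x t) ^ 2 = 4 * (a t ^ 2 * σ t ^ 2) * x t ^ 2 := by ring
            have h5 : a t ^ 2 * σ t ^ 2 ≤ 1 * A := by gcongr
            rw [h4]
            have h6 : (a t ^ 2 * σ t ^ 2) * x t ^ 2 ≤ A * x t ^ 2 := by
              rw [one_mul] at h5; gcongr
            have h7 : (σ t ^ 2) ^ 2 ≤ A ^ 2 := by gcongr
            have h8 : sqVariance * (σ t ^ 2) ^ 2 ≤ sqVariance * A ^ 2 := by gcongr
            nlinarith
          · have : 0 ≤ 8 * A * x t ^ 2 + 2 * sqVariance * A ^ 2 := by positivity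
            simpa using this
      _ = 8 * A * ∑ t, x t ^ 2 + n * (2 * sqVariance * A ^ 2) := by
          rw [Finset.sum_add_distrib, ← Finset.mul_sum]; simp
      _ ≤ 8 * A * (n * P) + n * (2 * sqVariance * A ^ 2) := by
          gcongr; exact hx
      _ = _ := by ring

/-- The variances are chosen with `v / σ² = 1 / a`. The logarithmic density is then `∑ log (1 / a) /
2`, plus a term that `hI` makes nonpositive, plus a centred quadratic form. Off `J` channel and
reference law coincide, so nothing is added. -/
theorem babble_info_tail (ha : ∀ t ∈ J, 0 < a t ∧ a t < 1) (hb : ∀ t ∈ J, 0 < b t)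
    {x : Fin n → ℝ} {s : ℝ} (hs : 0 < s)
    (hI : ∑ t ∈ J, (1 - a t) * x t ^ 2 / b t ≤ ∑ t ∈ J, (1 - a t)) :
    gaussianOut (babbleGain J a) (babbleScale J a b) x
      {y | ∑ t ∈ J, Real.log (1 / a t) / 2 + s <
        infoDensity (babbleGain J a) (babbleScale J a b) (babbleVar J a b) x y} ≤
      ENNReal.ofReal (n * (2 + sqVariance / 2) / s ^ 2) := by
  have hsplit : ∀ f : Fin n → ℝ, (∀ t ∉ J, f t = 0) → ∑ t, f t = ∑ t ∈ J, f t := by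
    intro f hf
    exact (Finset.sum_subset (Finset.subset_univ J) fun t _ ht => hf t ht).symm
  set σ := babbleScale J a b with hσ
  have hσ2 : ∀ t ∈ J, σ t ^ 2 = a t * (1 - a t) * b t := fun t ht => babbleScale_sq ha hb ht
  have hmeas : Measurable (infoDensity (babbleGain J a) σ (babbleVar J a b) x) := by
    unfold infoDensity
    exact Finset.measurable_sum _ fun t _ =>
      (measurable_logRatio _ _ _).comp (measurable_pi_apply t)
  refine gaussianOut_tail_le hmeas hs (fun t => if t ∈ J then σ t * x t / b t else 0)
    (fun t => if t ∈ J then (a t - 1) / 2 else 0) (fun z => ?_) ?_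
  · rw [infoDensity, hsplit, hsplit]
    · have key : ∀ t ∈ J, logRatio (babbleGain J a t * x t) (σ t) (babbleVar J a b t)
          (babbleGain J a t * x t + σ t * z t) = Real.log (1 / a t) / 2 +
          ((1 - a t) * x t ^ 2 / b t - (1 - a t)) / 2 +
          (σ t * x t / b t * z t + (a t - 1) / 2 * (z t ^ 2 - 1)) := by
        intro t ht
        have h1 := ha t ht
        have h2 := hb t ht
        have h3 : 0 < 1 - a t := by linarith
        have h0 := h1.1
        have hp : 0 < σ t ^ 2 := by rw [hσ2 t ht]; positivity
        have hg : babbleGain J a t = 1 - a t := if_pos ht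
        have hv : babbleVar J a b t = (1 - a t) * b t := if_pos ht
        have e1 : (1 - a t) * b t / σ t ^ 2 = 1 / a t := by
          rw [hσ2 t ht]; field_simp
        have e2 : ((1 - a t) * x t + σ t * z t - (1 - a t) * x t) ^ 2 / (2 * σ t ^ 2) =
            z t ^ 2 / 2 := by
          have hs0 : 0 < σ t := babbleScale_pos ha hb t
          field_simp; ring
        have e3 : ((1 - a t) * x t + σ t * z t) ^ 2 / (2 * ((1 - a t) * b t)) =
            (1 - a t) * x t ^ 2 / b t / 2 + σ t * x t / b t * z t + a t * z t ^ 2 / 2 := by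
          have : ((1 - a t) * x t + σ t * z t) ^ 2 = (1 - a t) ^ 2 * x t ^ 2 +
              2 * (1 - a t) * (σ t * x t * z t) + a t * (1 - a t) * b t * z t ^ 2 := by
            rw [← hσ2 t ht]; ring
          rw [this]
          field_simp
        rw [logRatio, hg, hv, e1, e2, e3]
        ring
      rw [Finset.sum_congr rfl key, Finset.sum_add_distrib, Finset.sum_add_distrib]
      have e4 : ∑ t ∈ J, ((1 - a t) * x t ^ 2 / b t - (1 - a t)) / 2 =
          (∑ t ∈ J, (1 - a t) * x t ^ 2 / b t - ∑ t ∈ J, (1 - a t)) / 2 := by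
        rw [← Finset.sum_div, Finset.sum_sub_distrib]
      rw [e4]
      have e : ∑ t ∈ J, ((if t ∈ J then σ t * x t / b t else 0) * z t +
          (if t ∈ J then (a t - 1) / 2 else 0) * (z t ^ 2 - 1)) =
          ∑ t ∈ J, (σ t * x t / b t * z t + (a t - 1) / 2 * (z t ^ 2 - 1)) :=
        Finset.sum_congr rfl fun t ht => by simp [ht]
      rw [e]
      linarith
    · intro t ht
      simp [ht]
    · intro t ht
      have hg : babbleGain J a t = 0 := if_neg ht
      have hv : babbleVar J a b t = 1 := if_neg ht
      have hs1 : σ t = 1 := if_neg ht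
      simp [logRatio, hg, hv, hs1]
  · have hq := sqVariance_nonneg
    rw [hsplit]
    · calc _ ≤ ∑ t ∈ J, (2 * ((1 - a t) * x t ^ 2 / b t) + sqVariance / 2) := by
            refine Finset.sum_le_sum fun t ht => ?_
            have h1 := ha t ht
            have h2 := hb t ht
            have h3 : 0 < 1 - a t := by linarith
            simp only [ht, if_true]
            have e1 : (σ t * x t / b t) ^ 2 = a t * ((1 - a t) * x t ^ 2 / b t) := by
              rw [div_pow, mul_pow, hσ2 t ht]; field_simp
            rw [e1]
            have h4 : 0 ≤ (1 - a t) * x t ^ 2 / b t := by positivity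
            have h5 : ((a t - 1) / 2) ^ 2 ≤ 1 / 4 := by nlinarith [h1.1, h1.2]
            nlinarith [h1.1, h1.2]
        _ = 2 * ∑ t ∈ J, (1 - a t) * x t ^ 2 / b t + J.card * (sqVariance / 2) := by
            rw [Finset.sum_add_distrib, ← Finset.mul_sum]; simp
        _ ≤ 2 * ∑ t ∈ J, (1 : ℝ) + J.card * (sqVariance / 2) := by
            have : ∑ t ∈ J, (1 - a t) ≤ ∑ t ∈ J, (1 : ℝ) :=
              Finset.sum_le_sum fun t ht => by linarith [(ha t ht).1]
            linarith
        _ = J.card * (2 + sqVariance / 2) := by simp; ring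
        _ ≤ n * (2 + sqVariance / 2) := by
            have : (J.card : ℝ) ≤ n := by
              exact_mod_cast (Finset.card_le_univ J).trans (by simp)
            gcongr
    · intro t ht
      simp [ht]

end Babble

/-! ### The error forced at finite block-length -/

/-- The mean push energy is at most a quarter of twice the energy bound `S` per unit mass, that is
`S / 2`; Markov's inequality concludes. -/
theorem replica_push_le {M n : ℕ} (J : Finset (Fin n)) (ν : Measure (Fin M × (Fin n → ℝ)))
    [IsFiniteMeasure ν] [Nonempty (Fin M × (Fin n → ℝ))]
    (κ : Kernel (Fin M × (Fin n → ℝ)) (Fin n → ℝ)) [IsMarkovKernel κ] {S τ r : ℝ}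
    (hτ : 0 < τ) (hr : S / 2 ≤ r * τ)
    (hS : ∀ᵐ θ ∂ν, ∑ t ∈ Jᶜ, θ.2 t ^ 2 ≤ S) :
    replica ν κ {q | τ ≤ ∑ t ∈ Jᶜ, ((q.2.2.2 t - q.2.1.2 t) / 2) ^ 2} ≤
      ENNReal.ofReal r * ν Set.univ := by
  have hm : Measurable fun q : (Fin n → ℝ) × (Fin M × (Fin n → ℝ)) × (Fin M × (Fin n → ℝ)) =>
      ENNReal.ofReal (∑ t ∈ Jᶜ, ((q.2.2.2 t - q.2.1.2 t) / 2) ^ 2) := by fun_prop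
  have h1 : ∫⁻ q, ENNReal.ofReal (∑ t ∈ Jᶜ, ((q.2.2.2 t - q.2.1.2 t) / 2) ^ 2) ∂(replica ν κ) ≤
      ENNReal.ofReal (S / 2) * ν Set.univ := by
    calc _ = ∑ t ∈ Jᶜ, ∫⁻ q, ENNReal.ofReal ((q.2.2.2 t / 2 - q.2.1.2 t / 2) ^ 2)
          ∂(replica ν κ) := by
          rw [← lintegral_finsetSum _ fun t _ => by fun_prop]
          refine lintegral_congr fun q => ?_
          rw [ENNReal.ofReal_sum_of_nonneg fun _ _ => sq_nonneg _]
          refine Finset.sum_congr rfl fun t _ => ?_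
          rw [sub_div]
      _ ≤ ∑ t ∈ Jᶜ, 2 * ∫⁻ θ, ENNReal.ofReal ((θ.2 t / 2) ^ 2) ∂ν :=
          Finset.sum_le_sum fun t _ =>
            lintegral_replica_sq_sub_le ν κ (f := fun θ => θ.2 t / 2) (by fun_prop)
      _ = 2 * ∫⁻ θ, ENNReal.ofReal (∑ t ∈ Jᶜ, (θ.2 t / 2) ^ 2) ∂ν := by
          rw [← Finset.mul_sum, ← lintegral_finsetSum _ fun t _ => by fun_prop]
          congr 1
          refine lintegral_congr fun q => ?_
          rw [ENNReal.ofReal_sum_of_nonneg fun _ _ => sq_nonneg _]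
      _ ≤ 2 * ∫⁻ θ, ENNReal.ofReal (S / 4) ∂ν := by
          refine mul_le_mul_right (lintegral_mono_ae ?_) _
          filter_upwards [hS] with θ hθ
          refine ENNReal.ofReal_le_ofReal ?_
          simp only [div_pow, ← Finset.sum_div]
          linarith
      _ = _ := by
          rw [lintegral_const, ← mul_assoc]
          congr 1
          rw [show (2 : ℝ≥0∞) = ENNReal.ofReal 2 by simp, ← ENNReal.ofReal_mul (by norm_num)]
          congr 1; ring
  have h2 := mul_meas_ge_le_lintegral hm (ENNReal.ofReal τ) (μ := replica ν κ)
  have h3 : {q : (Fin n → ℝ) × (Fin M × (Fin n → ℝ)) × (Fin M × (Fin n → ℝ)) |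
      τ ≤ ∑ t ∈ Jᶜ, ((q.2.2.2 t - q.2.1.2 t) / 2) ^ 2} ⊆
      {q | ENNReal.ofReal τ ≤ ENNReal.ofReal (∑ t ∈ Jᶜ, ((q.2.2.2 t - q.2.1.2 t) / 2) ^ 2)} :=
    fun q hq => ENNReal.ofReal_le_ofReal hq
  have h4 : ENNReal.ofReal τ ≠ 0 := by simpa using hτ
  refine (measure_mono h3).trans ?_
  rw [← ENNReal.mul_le_mul_iff_right h4 ENNReal.ofReal_ne_top]
  refine h2.trans (h1.trans ?_)
  rw [← mul_assoc]
  gcongr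
  rw [← ENNReal.ofReal_mul hτ.le]
  exact ENNReal.ofReal_le_ofReal (by linarith)

theorem attackEnergy_eq {n : ℕ} (J : Finset (Fin n)) (x y x' : Fin n → ℝ) :
    attackEnergy J x y x' = ∑ t ∈ J, (y t - x t) ^ 2 + ∑ t ∈ Jᶜ, ((x' t - x t) / 2) ^ 2 := by
  rw [attackEnergy, ← Finset.sum_add_sum_compl J]
  congr 1
  · exact Finset.sum_congr rfl fun t ht => by rw [babblePush, if_pos ht]
  · exact Finset.sum_congr rfl fun t ht => by rw [babblePush, if_neg (Finset.mem_compl.1 ht)]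

theorem le_of_le_add_mul {g X : ℝ≥0∞} (hg : g ≠ ∞) {q : ℝ} (hq : 0 ≤ q)
    (h : g ≤ X + ENNReal.ofReal q * g) : g * ENNReal.ofReal (1 - q) ≤ X := by
  rcases le_total 1 q with h1 | h1
  · rw [ENNReal.ofReal_of_nonpos (by linarith)]; simp
  · have e : g = ENNReal.ofReal q * g + g * ENNReal.ofReal (1 - q) := by
      rw [mul_comm, ← mul_add, ← ENNReal.ofReal_add hq (by linarith)]
      simp
    have hf : ENNReal.ofReal q * g ≠ ∞ := ENNReal.mul_ne_top ENNReal.ofReal_ne_top hg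
    have h2 : ENNReal.ofReal q * g + g * ENNReal.ofReal (1 - q) ≤ ENNReal.ofReal q * g + X := by
      rw [← e, add_comm]; exact h
    exact (ENNReal.add_le_add_iff_left hf).1 h2

/-- The error forced by a babble-and-push attack, at finite block-length. -/
theorem avgError_ge_of_attack {M n : ℕ} {P N : ℝ} (hN : 0 < N) (hn : 0 < n) (hM : M ≠ 0)
    (C : Code M n P) {J : Finset (Fin n)} (hJ : ∀ s t, s ≤ t → t ∈ J → s ∈ J)
    {a b : Fin n → ℝ} (ha : ∀ t ∈ J, 0 < a t ∧ a t < 1) (hb : ∀ t ∈ J, 0 < b t)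
    {A S δ s : ℝ} (hP : 0 ≤ P) (hA0 : 0 ≤ A) (hA : ∀ t ∈ J, a t * (1 - a t) * b t ≤ A) (hS0 : 0 ≤ S)
    (hδ : 0 < δ) (hs : 0 < s) (hS : ∑ t ∈ J, a t * b t + S / 2 ≤ (1 - δ) * (n * N))
    {G : Set (Fin n → ℝ)} (hG : MeasurableSet G)
    (hE : ∀ x ∈ G, ∑ t ∈ J, a t ^ 2 * x t ^ 2 ≤ ∑ t ∈ J, a t ^ 2 * b t)
    (hI : ∀ x ∈ G, ∑ t ∈ J, (1 - a t) * x t ^ 2 / b t ≤ ∑ t ∈ J, (1 - a t))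
    (hSG : ∀ x ∈ G, ∑ t ∈ Jᶜ, x t ^ 2 ≤ S) :
    messageLaw C (Set.univ ×ˢ G) * ENNReal.ofReal
      (δ / 2 - 2 * (n * (8 * A * P + 2 * sqVariance * A ^ 2) / (δ / 2 * (n * N)) ^ 2) -
        n * (2 + sqVariance / 2) / s ^ 2) ≤
      2 * avgError N C +
        ENNReal.ofReal (Real.exp (∑ t ∈ J, Real.log (1 / a t) / 2 + s)) * (M : ℝ≥0∞)⁻¹ := by
  have hq := sqVariance_nonneg
  have hnN : 0 < n * N := by positivity
  have := isFiniteMeasure_messageLaw C hM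
  have : NeZero M := ⟨hM⟩
  have hUG : MeasurableSet ((Set.univ : Set (Fin M)) ×ˢ G) := MeasurableSet.univ.prod hG
  -- Only codewords in `G` are attacked, and the fake codeword also comes from `G`, so both draws
  -- obey the energy and information bounds.
  set ν : Measure (Fin M × (Fin n → ℝ)) := (messageLaw C).restrict (Set.univ ×ˢ G) with hν
  have hνle : ν ≤ messageLaw C := Measure.restrict_le_self
  have hνu : ν Set.univ = messageLaw C (Set.univ ×ˢ G) := by simp [hν]
  have hνG : ∀ᵐ θ ∂ν, θ.2 ∈ G := by
    filter_upwards [ae_restrict_mem hUG] with θ hθ using hθ.2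
  have hνB : ∀ᵐ θ ∂ν, θ.2 ∈ ball n P := ae_restrict_of_ae (ae_messageLaw_ball C)
  set c := babbleGain J a with hc
  set σ := babbleScale J a b with hσ
  set v := babbleVar J a b with hv
  set κ := pairChannel M c σ with hκ
  set Eb := ∑ t ∈ J, a t * b t with hEb
  have hEb0 : 0 ≤ Eb := Finset.sum_nonneg fun t ht =>
    mul_nonneg (ha t ht).1.le (hb t ht).le
  set s1 := δ / 2 * (n * N) with hs1
  have hs1p : 0 < s1 := by positivity
  set β1 := n * (8 * A * P + 2 * sqVariance * A ^ 2) / s1 ^ 2 with hβ1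
  have hβ1p : 0 ≤ β1 := by positivity
  set β2 := n * (2 + sqVariance / 2) / s ^ 2 with hβ2
  have hβ2p : 0 ≤ β2 := by positivity
  -- What remains for the push after a babble of energy `Eb + s1`. Half of the slack `δ n N` absorbs
  -- fluctuations of the babble; the other half keeps the Markov bound at `1 - δ / 2`.
  set τ := n * N - Eb - s1 with hτ
  have hδ1 : δ ≤ 1 := by
    by_contra hcon
    nlinarith [mul_pos (sub_pos.2 (not_le.1 hcon)) hnN]
  have hτS : S / 2 + s1 ≤ τ := by rw [hτ, hs1]; nlinarith
  have hτp : 0 < τ := by linarith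
  set Bad : Set ((Fin n → ℝ) × (Fin M × (Fin n → ℝ))) :=
    {p | Eb + s1 < ∑ t ∈ J, (p.1 t - p.2.2 t) ^ 2} with hBad
  have hBadm : MeasurableSet Bad := measurableSet_lt (by fun_prop) (by fun_prop)
  have hBadp : ∀ᵐ θ ∂ν, κ θ {y | (y, θ) ∈ Bad} ≤ ENNReal.ofReal β1 := by
    filter_upwards [hνG, hνB] with θ h1 h2
    rw [hκ, pairChannel_apply]
    exact babble_energy_tail ha hb hs1p hA hA0 h2 (hE _ h1)
  have hpush : replica ν κ {q | τ ≤ ∑ t ∈ Jᶜ, ((q.2.2.2 t - q.2.1.2 t) / 2) ^ 2} ≤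
      ENNReal.ofReal (1 - δ / 2) * ν Set.univ := by
    refine replica_push_le J ν κ (S := S) hτp ?_ ?_
    · have h1 : τ ≤ n * N := by rw [hτ]; linarith
      have h2 : δ / 2 * τ ≤ s1 := by rw [hs1]; gcongr
      linarith
    · filter_upwards [hνG] with θ hθ using hSG _ hθ
  set Γ : ℝ≥0∞ := ENNReal.ofReal (Real.exp (∑ t ∈ J, Real.log (1 / a t) / 2 + s)) with hΓ
  have hcoll : replica ν κ {q | q.2.1.1 = q.2.2.1} ≤
      ENNReal.ofReal β2 * ν Set.univ + Γ * (M : ℝ≥0∞)⁻¹ := by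
    have hDm : Measurable fun p : (Fin n → ℝ) × (Fin M × (Fin n → ℝ)) =>
        ENNReal.ofReal (Real.exp (infoDensity c σ v p.2.2 p.1)) := by
      unfold infoDensity logRatio; fun_prop
    refine replica_same_message_le ν κ (refGaussian v) hDm (fun θ => ?_) Γ _ _ ?_ fun w => ?_
    · rw [hκ, pairChannel_apply]
      exact gaussianOut_eq_withDensity θ.2 (babbleScale_pos ha hb) (babbleVar_pos ha hb)
    · filter_upwards [hνG] with θ hθ
      rw [hκ, pairChannel_apply]
      refine le_trans (measure_mono fun y hy => ?_) (babble_info_tail ha hb hs (hI _ hθ))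
      have h1 : Γ < ENNReal.ofReal (Real.exp (infoDensity c σ v θ.2 y)) := hy
      rw [hΓ, ENNReal.ofReal_lt_ofReal_iff (Real.exp_pos _), Real.exp_lt_exp] at h1
      exact h1
    · exact (hνle _).trans (messageLaw_message_le C w)
  -- Outside confusion, something went wrong: an expensive push, an expensive babble seen from
  -- either draw, or equal messages.
  have hcover : (Set.univ : Set ((Fin n → ℝ) × (Fin M × (Fin n → ℝ)) × (Fin M × (Fin n → ℝ)))) ⊆
      confusion M J (n * N) ∪ ({q | τ ≤ ∑ t ∈ Jᶜ, ((q.2.2.2 t - q.2.1.2 t) / 2) ^ 2} ∪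
        ({q | (q.1, q.2.1) ∈ Bad} ∪ ({q | (q.1, q.2.2) ∈ Bad} ∪ {q | q.2.1.1 = q.2.2.1}))) := by
    intro q _
    by_contra hcon
    simp only [Set.mem_union, not_or] at hcon
    obtain ⟨h0, h1, h2, h3, h4⟩ := hcon
    have h1' : ∑ t ∈ Jᶜ, ((q.2.2.2 t - q.2.1.2 t) / 2) ^ 2 < τ := not_le.1 h1
    have h2' : ∑ t ∈ J, (q.1 t - q.2.1.2 t) ^ 2 ≤ Eb + s1 := not_lt.1 h2
    have h3' : ∑ t ∈ J, (q.1 t - q.2.2.2 t) ^ 2 ≤ Eb + s1 := not_lt.1 h3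
    have h5 : ∑ t ∈ Jᶜ, ((q.2.1.2 t - q.2.2.2 t) / 2) ^ 2 =
        ∑ t ∈ Jᶜ, ((q.2.2.2 t - q.2.1.2 t) / 2) ^ 2 :=
      Finset.sum_congr rfl fun t _ => by ring
    refine h0 ⟨?_, ?_, h4⟩
    · rw [attackEnergy_eq]; linarith
    · rw [attackEnergy_eq, h5]; linarith
  have hgood : replica ν κ (confusion M J (n * N)) ≤ 2 * avgError N C :=
    replica_confusion_le_avgError hN.le C hJ (fun t ht => if_neg ht) ν hνle
  have hb1 := replica_fst_le ν κ hBadm hBadp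
  have hb2 := replica_snd_le ν κ hBadm hBadp
  have htot : ν Set.univ ≤ (2 * avgError N C + Γ * (M : ℝ≥0∞)⁻¹) +
      ENNReal.ofReal (1 - δ / 2 + 2 * β1 + β2) * ν Set.univ := by
    rw [← replica_univ ν κ]
    refine (measure_mono hcover).trans ?_
    refine (measure_union_le _ _).trans ((add_le_add hgood ((measure_union_le _ _).trans
      (add_le_add hpush ((measure_union_le _ _).trans (add_le_add hb1
        ((measure_union_le _ _).trans (add_le_add hb2 hcoll))))))).trans (le_of_eq ?_))
    rw [replica_univ, ENNReal.ofReal_add (by linarith) hβ2p, ENNReal.ofReal_add (by linarith)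
      (by linarith), two_mul β1, ENNReal.ofReal_add hβ1p hβ1p]
    ring
  have := le_of_le_add_mul (measure_ne_top ν _) (by linarith) htot
  rw [hνu] at this
  convert this using 3
  ring

/-- The hypotheses on an attack that force a decoding error: `J` is the babbling period, `a` the
babbling strength, `b` the power profile, `S` a bound for the signal energy off `J`, `G` a set of
codewords. -/
structure IsAttack (n : ℕ) (N A δ : ℝ) (J : Finset (Fin n)) (a b : Fin n → ℝ) (S : ℝ)
    (G : Set (Fin n → ℝ)) : Prop where
  lower : ∀ s t, s ≤ t → t ∈ J → s ∈ J
  strength : ∀ t ∈ J, 0 < a t ∧ a t < 1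
  profile : ∀ t ∈ J, 0 < b t
  noise_le : ∀ t ∈ J, a t * (1 - a t) * b t ≤ A
  rest_nonneg : 0 ≤ S
  budget : ∑ t ∈ J, a t * b t + S / 2 ≤ (1 - δ) * (n * N)
  measurable : MeasurableSet G
  energy : ∀ x ∈ G, ∑ t ∈ J, a t ^ 2 * x t ^ 2 ≤ ∑ t ∈ J, a t ^ 2 * b t
  info : ∀ x ∈ G, ∑ t ∈ J, (1 - a t) * x t ^ 2 / b t ≤ ∑ t ∈ J, (1 - a t)
  rest : ∀ x ∈ G, ∑ t ∈ Jᶜ, x t ^ 2 ≤ S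

theorem ne_zero_of_rate_pos {M n : ℕ} (h : 0 < rate M n) : M ≠ 0 := by
  rintro rfl
  simp [rate] at h

theorem cast_eq_exp_rate {M n : ℕ} (hn : 0 < n) (hM : M ≠ 0) :
    (M : ℝ) = Real.exp (n * rate M n * Real.log 2) := by
  have h2 : Real.log 2 ≠ 0 := (Real.log_pos one_lt_two).ne'
  have hn' : (n : ℝ) ≠ 0 := by positivity
  have hM' : (0 : ℝ) < M := by positivity
  have : n * rate M n * Real.log 2 = Real.log M := by
    rw [rate, Real.logb]; field_simp
  rw [this, Real.exp_log hM']

/-- With all parameters other than `n` fixed, the Chebyshev terms are `O(1 / n)` and the collision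
term decays exponentially, so a fixed fraction of `g δ` survives. -/
theorem exists_avgError_ge_of_attack {P N A δ ε g : ℝ} (hP : 0 ≤ P) (hN : 0 < N) (hA : 0 ≤ A)
    (hδ : 0 < δ) (hε : 0 < ε) (hg : 0 < g) :
    ∃ n₀ : ℕ, ∀ n : ℕ, n₀ ≤ n → ∀ (M : ℕ) (C : Code M n P) (J : Finset (Fin n))
      (a b : Fin n → ℝ) (S : ℝ) (G : Set (Fin n → ℝ)), IsAttack n N A δ J a b S G →
      M ≠ 0 → ENNReal.ofReal g ≤ messageLaw C (Set.univ ×ˢ G) →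
      ∑ t ∈ J, Real.log (1 / a t) / 2 ≤ n * (rate M n - ε) * Real.log 2 →
      ENNReal.ofReal (g * δ / 16) ≤ avgError N C := by
  have hl2 : 0 < Real.log 2 := Real.log_pos one_lt_two
  have hq := sqVariance_nonneg
  set c1 := 8 * (8 * A * P + 2 * sqVariance * A ^ 2) / (δ * N) ^ 2 with hc1
  set c2 := (2 + sqVariance / 2) * 4 / (ε * Real.log 2) ^ 2 with hc2
  have t1 : Filter.Tendsto (fun n : ℕ => (c1 + c2) / (n : ℝ)) Filter.atTop (nhds 0) :=
    tendsto_const_div_atTop_nhds_zero_nat _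
  have t2 : Filter.Tendsto (fun n : ℕ => Real.exp (-((n : ℝ) * (ε * Real.log 2 / 2))))
      Filter.atTop (nhds 0) :=
    Real.tendsto_exp_neg_atTop_nhds_zero.comp
      (tendsto_natCast_atTop_atTop.atTop_mul_const (by positivity))
  have hd : 0 < δ / 4 := by positivity
  have hgd : 0 < g * δ / 8 := by positivity
  obtain ⟨n₀, hn₀⟩ := Filter.eventually_atTop.1
    (((t1.eventually_lt_const hd).and (t2.eventually_lt_const hgd)).and
      (Filter.eventually_gt_atTop 0))
  refine ⟨n₀, fun n hn M C J a b S G h hM hG hR => ?_⟩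
  obtain ⟨⟨h1, h2⟩, hn0⟩ := hn₀ n hn
  have hn0' : (0 : ℝ) < n := by exact_mod_cast hn0
  -- Half of the rate margin pays for the fluctuation of the information density; the other half
  -- makes `Γ / M` at most `exp (-n ε log 2 / 2)`.
  have hs : 0 < n * (ε * Real.log 2 / 2) := by positivity
  have key := avgError_ge_of_attack hN hn0 hM C h.lower h.strength h.profile hP hA h.noise_le
    h.rest_nonneg hδ hs h.budget h.measurable h.energy h.info h.rest
  have e1 : δ / 4 ≤ δ / 2 - 2 * (n * (8 * A * P + 2 * sqVariance * A ^ 2) /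
      (δ / 2 * (n * N)) ^ 2) - n * (2 + sqVariance / 2) / (n * (ε * Real.log 2 / 2)) ^ 2 := by
    have e : 2 * (n * (8 * A * P + 2 * sqVariance * A ^ 2) / (δ / 2 * (n * N)) ^ 2) +
        n * (2 + sqVariance / 2) / (n * (ε * Real.log 2 / 2)) ^ 2 = (c1 + c2) / n := by
      rw [hc1, hc2]; field_simp; ring
    linarith
  have e2 : ENNReal.ofReal (Real.exp (∑ t ∈ J, Real.log (1 / a t) / 2 +
      n * (ε * Real.log 2 / 2))) * (M : ℝ≥0∞)⁻¹ ≤ ENNReal.ofReal (g * δ / 8) := by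
    have hM0 : (0 : ℝ) < M := by positivity
    rw [← ENNReal.ofReal_natCast, ← ENNReal.ofReal_inv_of_pos hM0,
      ← ENNReal.ofReal_mul (Real.exp_pos _).le, cast_eq_exp_rate hn0 hM, ← Real.exp_neg,
      ← Real.exp_add]
    refine ENNReal.ofReal_le_ofReal (le_trans (Real.exp_le_exp.2 ?_) h2.le)
    linarith
  have e3 : ENNReal.ofReal (g * δ / 4) ≤ 2 * avgError N C + ENNReal.ofReal (g * δ / 8) := by
    refine le_trans ?_ (key.trans (add_le_add le_rfl e2))
    rw [show g * δ / 4 = g * (δ / 4) by ring, ENNReal.ofReal_mul hg.le]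
    exact mul_le_mul' hG (ENNReal.ofReal_le_ofReal e1)
  have e4 : ENNReal.ofReal (g * δ / 4) = 2 * ENNReal.ofReal (g * δ / 16) +
      ENNReal.ofReal (g * δ / 8) := by
    rw [show (2 : ℝ≥0∞) = ENNReal.ofReal 2 by simp, ← ENNReal.ofReal_mul (by norm_num),
      ← ENNReal.ofReal_add (by positivity) hgd.le]
    congr 1; ring
  rw [e4, ENNReal.add_le_add_iff_right ENNReal.ofReal_ne_top] at e3
  exact (ENNReal.mul_le_mul_iff_right (by norm_num) (by norm_num)).1 e3

/-! ### Chunks of time and energy profiles -/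

/-- The times of chunk `k`. -/
def fiber {n K : ℕ} (idx : Fin n → Fin K) (k : Fin K) : Finset (Fin n) :=
  Finset.univ.filter fun t => idx t = k

/-- The times of the chunks in `s`. -/
def block {n K : ℕ} (idx : Fin n → Fin K) (s : Finset (Fin K)) : Finset (Fin n) :=
  Finset.univ.filter fun t => idx t ∈ s

theorem mem_fiber {n K : ℕ} {idx : Fin n → Fin K} {k : Fin K} {t : Fin n} :
    t ∈ fiber idx k ↔ idx t = k := by simp [fiber]

theorem mem_block {n K : ℕ} {idx : Fin n → Fin K} {s : Finset (Fin K)} {t : Fin n} :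
    t ∈ block idx s ↔ idx t ∈ s := by simp [block]

theorem sum_block {n K : ℕ} (idx : Fin n → Fin K) (s : Finset (Fin K)) (f : Fin n → ℝ) :
    ∑ t ∈ block idx s, f t = ∑ k ∈ s, ∑ t ∈ fiber idx k, f t := by
  rw [← Finset.sum_fiberwise_of_maps_to (s := block idx s) (t := s) (g := idx)
    fun t ht => mem_block.1 ht]
  refine Finset.sum_congr rfl fun k hk => Finset.sum_congr ?_ fun _ _ => rfl
  ext t
  simp only [Finset.mem_filter, mem_block, mem_fiber]
  exact ⟨fun h => h.2, fun h => ⟨h ▸ hk, h⟩⟩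

theorem sum_univ_fiber {n K : ℕ} (idx : Fin n → Fin K) (f : Fin n → ℝ) :
    ∑ t, f t = ∑ k, ∑ t ∈ fiber idx k, f t := by
  have h := sum_block idx Finset.univ f
  rwa [show block idx Finset.univ = Finset.univ by ext; simp [block]] at h

theorem sum_block_mul {n K : ℕ} (idx : Fin n → Fin K) (s : Finset (Fin K)) (F : Fin K → ℝ)
    (f : Fin n → ℝ) :
    ∑ t ∈ block idx s, F (idx t) * f t = ∑ k ∈ s, F k * ∑ t ∈ fiber idx k, f t := by
  rw [sum_block]
  refine Finset.sum_congr rfl fun k _ => ?_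
  rw [Finset.mul_sum]
  exact Finset.sum_congr rfl fun t ht => by rw [mem_fiber.1 ht]

theorem sum_block_comp {n K : ℕ} (idx : Fin n → Fin K) (s : Finset (Fin K)) (F : Fin K → ℝ) :
    ∑ t ∈ block idx s, F (idx t) = ∑ k ∈ s, F k * ((fiber idx k).card : ℝ) := by
  simpa using sum_block_mul idx s F fun _ => 1

/-- A cut of `n` times into `K` consecutive chunks of comparable lengths. -/
structure IsChunking (n K : ℕ) (idx : Fin n → Fin K) : Prop where
  mono : Monotone idx
  le_card : ∀ k, (n : ℝ) / (2 * K) ≤ (fiber idx k).card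
  card_le : ∀ k, ((fiber idx k).card : ℝ) ≤ 2 * n / K

theorem exists_isChunking {n K : ℕ} (hK : 0 < K) (hn : 2 * K ≤ n) :
    ∃ idx : Fin n → Fin K, IsChunking n K idx := by
  have hn0 : 0 < n := by omega
  let idx : Fin n → Fin K := fun t => ⟨t * K / n, Nat.div_lt_of_lt_mul
    (Nat.mul_lt_mul_of_pos_right t.2 hK)⟩
  -- Chunk `k` consists of the times from `⌈k n / K⌉` up to, but excluding, `⌈(k + 1) n / K⌉`.
  have hcard : ∀ k : Fin K, (fiber idx k).card =
      ((k + 1) * n + K - 1) / K - (k * n + K - 1) / K := by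
    intro k
    rw [← Nat.card_Ico, ← Finset.card_map Fin.valEmbedding]
    congr 1
    ext t
    have e1 : (k * n + K - 1) / K ≤ t ↔ k * n ≤ t * K := by
      rw [← Nat.lt_succ_iff, Nat.div_lt_iff_lt_mul hK, Nat.succ_mul]
      omega
    have e2 : t < ((k + 1) * n + K - 1) / K ↔ t * K < (k + 1) * n := by
      rw [← Nat.succ_le_iff, Nat.le_div_iff_mul_le hK, Nat.succ_mul]
      omega
    rw [Finset.mem_Ico, e1, e2]
    simp only [Finset.mem_map, mem_fiber, Fin.valEmbedding_apply, idx, Fin.ext_iff]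
    constructor
    · rintro ⟨r, hr, rfl⟩
      exact (Nat.div_eq_iff hn0).1 hr |> fun h => by
        constructor
        · exact h.1
        · have := h.2; rw [Nat.succ_mul]; omega
    · rintro ⟨h1, h2⟩
      have ht : t < n := by
        have : t * K < n * K := h2.trans_le (by
          rw [Nat.mul_comm n]; exact Nat.mul_le_mul_right _ k.2)
        exact Nat.lt_of_mul_lt_mul_right this
      refine ⟨⟨t, ht⟩, ?_, rfl⟩
      exact Nat.div_eq_of_lt_le h1 h2
  have hdiv : ∀ u : ℕ, (u : ℝ) ≤ ((u + K - 1) / K : ℕ) * K ∧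
      (((u + K - 1) / K : ℕ) : ℝ) * K ≤ u + K - 1 := by
    intro u
    have h1 := Nat.div_add_mod (u + K - 1) K
    have h2 := Nat.mod_lt (u + K - 1) hK
    constructor
    · have : u ≤ (u + K - 1) / K * K := by rw [Nat.mul_comm]; omega
      exact_mod_cast this
    · have : (u + K - 1) / K * K + 1 ≤ u + K := by rw [Nat.mul_comm]; omega
      have : (((u + K - 1) / K * K + 1 : ℕ) : ℝ) ≤ (u + K : ℕ) := by exact_mod_cast this
      push_cast at this
      linarith
  have hK' : (0 : ℝ) < K := by exact_mod_cast hK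
  have hn' : (2 : ℝ) * K ≤ n := by exact_mod_cast hn
  have hle : ∀ k : Fin K, (k * n + K - 1) / K ≤ ((k + 1) * n + K - 1) / K := fun k =>
    Nat.div_le_div_right (by
      have : (k : ℕ) * n ≤ (k + 1) * n := Nat.mul_le_mul_right _ (Nat.le_succ _)
      omega)
  refine ⟨idx, ⟨fun s t hst => ?_, fun k => ?_, fun k => ?_⟩⟩
  · exact Nat.div_le_div_right (Nat.mul_le_mul_right _ hst)
  · rw [hcard, Nat.cast_sub (hle k), div_le_iff₀ (by positivity)]
    have h1 := (hdiv ((k + 1) * n)).1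
    have h2 := (hdiv (k * n)).2
    push_cast at h1 h2 ⊢
    nlinarith
  · rw [hcard, Nat.cast_sub (hle k), le_div_iff₀ hK']
    have h1 := (hdiv ((k + 1) * n)).2
    have h2 := (hdiv (k * n)).1
    push_cast at h1 h2 ⊢
    nlinarith

/-- The codewords whose energy in each chunk `k` is at most `B k`. -/
def chunkBall {n K : ℕ} (idx : Fin n → Fin K) (B : Fin K → ℝ) : Set (Fin n → ℝ) :=
  {x | ∀ k, ∑ t ∈ fiber idx k, x t ^ 2 ≤ B k}

theorem measurableSet_chunkBall {n K : ℕ} (idx : Fin n → Fin K) (B : Fin K → ℝ) :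
    MeasurableSet (chunkBall idx B) := by
  have : chunkBall idx B = ⋂ k, {x : Fin n → ℝ | ∑ t ∈ fiber idx k, x t ^ 2 ≤ B k} := by
    ext x; simp [chunkBall]
  rw [this]
  exact MeasurableSet.iInter fun k => measurableSet_le (by fun_prop) measurable_const

/-- With strength and profile constant on chunks, the weighted energies in `IsAttack` depend on a
codeword only through its chunk energies, which `B` bounds. -/
theorem isAttack_of_chunks {n K : ℕ} {N A δ : ℝ} (hn : 0 < n) {idx : Fin n → Fin K}
    (hidx : IsChunking n K idx) {B : Fin K → ℝ} (hB : ∀ k, 0 < B k)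
    (hBA : ∀ k, B k / (fiber idx k).card ≤ A) {α : Fin K → ℝ} (j : Fin K)
    (hα : ∀ k ≤ j, 0 < α k ∧ α k < 1)
    (hbudget : ∑ k ∈ Finset.Iic j, α k * B k + (∑ k ∈ Finset.Ioi j, B k) / 2 ≤
      (1 - δ) * (n * N)) :
    IsAttack n N A δ (block idx (Finset.Iic j)) (fun t => α (idx t))
      (fun t => B (idx t) / (fiber idx (idx t)).card) (∑ k ∈ Finset.Ioi j, B k)
      (chunkBall idx B) := by
  have hK : 0 < K := j.pos
  have hL : ∀ k, (0 : ℝ) < (fiber idx k).card := fun k =>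
    lt_of_lt_of_le (by positivity) (hidx.le_card k)
  have hmem : ∀ {t}, t ∈ block idx (Finset.Iic j) → idx t ≤ j := fun h => by
    simpa [mem_block] using h
  have hsum : ∀ F : Fin K → ℝ, ∑ t ∈ block idx (Finset.Iic j),
      F (idx t) * (B (idx t) / (fiber idx (idx t)).card) = ∑ k ∈ Finset.Iic j, F k * B k := by
    intro F
    rw [sum_block_comp idx _ fun k => F k * (B k / (fiber idx k).card)]
    refine Finset.sum_congr rfl fun k _ => ?_
    have := (hL k).ne'
    field_simp
  refine ⟨?_, fun t ht => hα _ (hmem ht), fun t _ => div_pos (hB _) (hL _), fun t ht => ?_,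
    Finset.sum_nonneg fun k _ => (hB k).le, ?_, measurableSet_chunkBall idx B, fun x hx => ?_,
    fun x hx => ?_, fun x hx => ?_⟩
  · intro s t hst ht
    simp only [mem_block, Finset.mem_Iic] at ht ⊢
    exact (hidx.mono hst).trans ht
  · have h1 := hα _ (hmem ht)
    have h2 : 0 < B (idx t) / (fiber idx (idx t)).card := div_pos (hB _) (hL _)
    refine le_trans (mul_le_of_le_one_left h2.le ?_) (hBA (idx t))
    nlinarith [h1.1, h1.2]
  · rw [hsum]; exact hbudget
  · rw [hsum fun k => α k ^ 2, sum_block_mul idx _ fun k => α k ^ 2]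
    exact Finset.sum_le_sum fun k _ => mul_le_mul_of_nonneg_left (hx k) (sq_nonneg _)
  · have e : ∀ t, (1 - α (idx t)) * x t ^ 2 / (B (idx t) / (fiber idx (idx t)).card) =
        (1 - α (idx t)) / (B (idx t) / (fiber idx (idx t)).card) * x t ^ 2 := fun t => by ring
    simp only [e]
    rw [sum_block_mul idx _ (fun k => (1 - α k) / (B k / (fiber idx k).card)),
      sum_block_comp idx _ fun k => 1 - α k]
    refine Finset.sum_le_sum fun k hk => ?_
    have h1 := hα k (Finset.mem_Iic.1 hk)
    have h2 : 0 < 1 - α k := by linarith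
    have h3 := hL k
    have h4 := hB k
    calc (1 - α k) / (B k / (fiber idx k).card) * ∑ t ∈ fiber idx k, x t ^ 2
        ≤ (1 - α k) / (B k / (fiber idx k).card) * B k := by
          gcongr; exact hx k
      _ = _ := by field_simp
  · have e : (block idx (Finset.Iic j))ᶜ = block idx (Finset.Ioi j) := by
      ext t; simp [mem_block]
    rw [e, sum_block]
    exact Finset.sum_le_sum fun k _ => hx k

/-- Pigeonhole over the `(⌊P / η⌋₊ + 1) ^ K` grid cells. `B` is the upper corner of the heaviest
cell; the cell contains a word of the signal ball, so the corner exceeds the budget by at most one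
mesh per chunk. -/
theorem exists_chunkBall_mass {M n K : ℕ} {P η : ℝ} (C : Code M n P) (hM : M ≠ 0) (hn : 0 < n)
    (hη : 0 < η) (idx : Fin n → Fin K) :
    ∃ B : Fin K → ℝ, (∀ k, 0 < B k) ∧ ∑ k, B k ≤ n * (P + K * η) ∧
      ENNReal.ofReal (1 / (⌊P / η⌋₊ + 1) ^ K) ≤
        messageLaw C (Set.univ ×ˢ chunkBall idx B) := by
  set D := ⌊P / η⌋₊ with hD
  have hn' : (0 : ℝ) < n := by exact_mod_cast hn
  have hηn : 0 < η * n := by positivity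
  let cp : Fin K → (Fin n → ℝ) → ℝ := fun k x => ∑ t ∈ fiber idx k, x t ^ 2
  have hcp : ∀ k x, 0 ≤ cp k x := fun k x => Finset.sum_nonneg fun _ _ => sq_nonneg _
  let G : (Fin K → Fin (D + 1)) → Set (Fin n → ℝ) := fun f =>
    {x | x ∈ ball n P ∧ ∀ k, (f k : ℝ) * (η * n) ≤ cp k x ∧ cp k x ≤ ((f k : ℝ) + 1) * (η * n)}
  have hcover : (Set.univ : Set (Fin M)) ×ˢ ball n P ⊆ ⋃ f, Set.univ ×ˢ G f := by
    rintro ⟨w, x⟩ ⟨-, hx⟩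
    have hx' : ∑ t, x t ^ 2 ≤ n * P := hx
    have hfl : ∀ k, ⌊cp k x / (η * n)⌋₊ < D + 1 := by
      intro k
      refine Nat.lt_succ_of_le (Nat.floor_le_floor ?_)
      have : cp k x ≤ n * P := le_trans (Finset.sum_le_sum_of_subset_of_nonneg
        (Finset.subset_univ _) fun _ _ _ => sq_nonneg _) hx'
      rw [div_le_div_iff₀ hηn hη]
      nlinarith
    refine Set.mem_iUnion.2 ⟨fun k => ⟨⌊cp k x / (η * n)⌋₊, hfl k⟩, trivial, hx, fun k => ?_⟩
    have h1 := Nat.floor_le (div_nonneg (hcp k x) hηn.le)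
    have h2 := Nat.lt_floor_add_one (cp k x / (η * n))
    rw [le_div_iff₀ hηn] at h1
    rw [div_lt_iff₀ hηn] at h2
    exact ⟨h1, h2.le⟩
  have h1 : 1 ≤ ∑ f, messageLaw C (Set.univ ×ˢ G f) := by
    rw [← messageLaw_univ C hM]
    refine le_trans (le_of_eq ?_) ((measure_mono hcover).trans (measure_iUnion_fintype_le _ _))
    refine measure_congr ?_
    filter_upwards [ae_messageLaw_ball C] with θ hθ
    exact propext ⟨fun _ => ⟨trivial, hθ⟩, fun _ => trivial⟩
  obtain ⟨f, hf⟩ := Finite.exists_max fun f => messageLaw C (Set.univ ×ˢ G f)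
  have h2 : (1 : ℝ≥0∞) ≤ ((D + 1) ^ K : ℕ) * messageLaw C (Set.univ ×ˢ G f) := by
    refine h1.trans ((Finset.sum_le_card_nsmul _ _ _ fun g _ => hf g).trans (le_of_eq ?_))
    simp
  have h3 : ENNReal.ofReal (1 / ((D : ℝ) + 1) ^ K) ≤ messageLaw C (Set.univ ×ˢ G f) := by
    have hp : (0 : ℝ) < ((D : ℝ) + 1) ^ K := by positivity
    rw [one_div, ENNReal.ofReal_inv_of_pos hp, ENNReal.inv_le_iff_le_mul
      (fun _ => by simpa using hp) (by simp)]
    convert h2 using 2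
    rw [← ENNReal.ofReal_natCast]
    push_cast
    rfl
  have hne : (G f).Nonempty := by
    by_contra hcon
    rw [Set.not_nonempty_iff_eq_empty] at hcon
    rw [hcon, Set.prod_empty, measure_empty] at h3
    have : 0 < ENNReal.ofReal (1 / ((D : ℝ) + 1) ^ K) := by
      rw [ENNReal.ofReal_pos]; positivity
    exact absurd h3 (not_le.2 this)
  obtain ⟨x, hx, hxf⟩ := hne
  refine ⟨fun k => ((f k : ℝ) + 1) * (η * n), fun k => by positivity, ?_, h3.trans
    (measure_mono (Set.prod_mono le_rfl fun y hy k => (hy.2 k).2))⟩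
  calc ∑ k, ((f k : ℝ) + 1) * (η * n) ≤ ∑ k, (cp k x + η * n) :=
        Finset.sum_le_sum fun k _ => by linarith [(hxf k).1]
    _ = ∑ t, x t ^ 2 + K * (η * n) := by
        rw [Finset.sum_add_distrib, sum_univ_fiber idx]; simp [cp]
    _ ≤ n * P + K * (η * n) := by gcongr; exact hx
    _ = _ := by ring

/-! ### From the optimization to an attack -/

theorem exists_feasible_lt {n : ℕ} {P N R ε : ℝ} (hε : 0 < ε) {p : Fin n → ℝ}
    (hp : p ∈ signalPowers n P)
    (h : optValue n P N + ((3 * ε : ℝ) : EReal) ≤ (R : EReal)) :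
    ∃ a ∈ feasible n P N p,
      1 / (2 * n) * ∑ t ∈ Finset.Iic a.2, Real.logb 2 (p t / a.1 t) < R - 2 * ε := by
  by_contra hcon
  push Not at hcon
  have h1 : ((R - 2 * ε : ℝ) : EReal) ≤ optValue n P N := by
    refine le_iSup₂_of_le p hp (le_iInf₂ fun a ha => ?_)
    exact_mod_cast hcon a ha
  have h2 : ((R - 2 * ε : ℝ) : EReal) + ((3 * ε : ℝ) : EReal) ≤ (R : EReal) :=
    (add_le_add h1 le_rfl).trans h
  have h3 : R - 2 * ε + 3 * ε ≤ R := by exact_mod_cast h2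
  linarith

theorem lt_of_feasible_lt {n : ℕ} {P N R ε : ℝ} {p : Fin n → ℝ} {a : (Fin n → ℝ) × Fin n}
    (ha : a ∈ feasible n P N p)
    (h : 1 / (2 * n) * ∑ t ∈ Finset.Iic a.2, Real.logb 2 (p t / a.1 t) < R - 2 * ε) :
    2 * ε < R := by
  have : 0 ≤ 1 / (2 * n) * ∑ t ∈ Finset.Iic a.2, Real.logb 2 (p t / a.1 t) := by
    refine mul_nonneg (by positivity) (Finset.sum_nonneg fun t ht => ?_)
    refine Real.logb_nonneg one_lt_two ?_
    rw [one_le_div (ha.1.1 t)]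
    exact ha.2.1 t (Finset.mem_Iic.1 ht)
  linarith

/-- Rounding a feasible pair up to the end of a chunk and averaging the noise over the chunks. -/
theorem exists_chunk_noise {n K : ℕ} {P N R ε : ℝ} (hn : 0 < n) {idx : Fin n → Fin K}
    (hidx : IsChunking n K idx) {Q : Fin K → ℝ} (hQ : ∀ k, 0 < Q k)
    {a : (Fin n → ℝ) × Fin n}
    (ha : a ∈ feasible n P N fun t => Q (idx t) / (fiber idx (idx t)).card)
    (h : 1 / (2 * n) * ∑ t ∈ Finset.Iic a.2,
      Real.logb 2 (Q (idx t) / (fiber idx (idx t)).card / a.1 t) < R - 2 * ε) :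
    ∃ (j : Fin K) (q : Fin K → ℝ), (∀ k ≤ j, 0 < q k ∧ q k ≤ Q k) ∧
      (n * P - ∑ k ∈ Finset.Iic j, Q k) / 2 + ∑ k ∈ Finset.Iic j, q k ≤ n * N ∧
      ∑ k ∈ Finset.Iic j, ((fiber idx k).card : ℝ) * Real.log (Q k / q k) ≤
        2 * n * (R - 2 * ε) * Real.log 2 + 2 * n / K * Real.log 2 := by
  obtain ⟨q, m⟩ := a
  obtain ⟨⟨hq0, hqN⟩, hqp, hbud⟩ := ha
  have hl2 : 0 < Real.log 2 := Real.log_pos one_lt_two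
  have hn' : (0 : ℝ) < n := by exact_mod_cast hn
  have hK : 0 < K := (idx m).pos
  have hL : ∀ k, (0 : ℝ) < (fiber idx k).card := fun k =>
    lt_of_lt_of_le (by positivity) (hidx.le_card k)
  set p : Fin n → ℝ := fun t => Q (idx t) / (fiber idx (idx t)).card with hp
  have hp0 : ∀ t, 0 < p t := fun t => div_pos (hQ _) (hL _)
  simp only at hq0 hqN hqp hbud h
  set j := idx m with hj
  set J := block idx (Finset.Iic j) with hJ
  -- Between `m` and the end of its chunk the jammer babbles at half the signal power. This costs
  -- exactly what the push reserved there, and `log 2` per time in the log-ratio sum, over at most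
  -- `2 n / K` times.
  let q' : Fin n → ℝ := fun t => if t ≤ m then q t else p t / 2
  have hq'0 : ∀ t, 0 < q' t := fun t => by
    simp only [q']; split_ifs
    · exact hq0 t
    · exact half_pos (hp0 t)
  have hq'p : ∀ t, q' t ≤ p t := fun t => by
    simp only [q']; split_ifs with ht
    · exact hqp t ht
    · linarith [hp0 t]
  have hsub : Finset.Iic m ⊆ J := fun t ht => by
    rw [hJ, mem_block]
    exact Finset.mem_Iic.2 (hidx.mono (Finset.mem_Iic.1 ht))
  have hsplit : ∀ f : Fin n → ℝ, ∑ t ∈ J, f t = ∑ t ∈ Finset.Iic m, f t +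
      ∑ t ∈ J \ Finset.Iic m, f t := fun f => by
    rw [add_comm, Finset.sum_sdiff hsub]
  have hfst : ∀ t ∈ Finset.Iic m, q' t = q t := fun t ht => if_pos (Finset.mem_Iic.1 ht)
  have hsnd : ∀ t ∈ J \ Finset.Iic m, q' t = p t / 2 := fun t ht =>
    if_neg fun hh => (Finset.mem_sdiff.1 ht).2 (Finset.mem_Iic.2 hh)
  have hpQ : ∀ k, ∑ t ∈ fiber idx k, p t = Q k := by
    intro k
    have : ∀ t ∈ fiber idx k, p t = Q k / (fiber idx k).card := fun t ht => by
      simp only [hp, mem_fiber.1 ht]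
    rw [Finset.sum_congr rfl this, Finset.sum_const, nsmul_eq_mul]
    have := (hL k).ne'
    field_simp
  have hne : ∀ k, (fiber idx k).Nonempty := fun k => by
    rw [← Finset.card_pos]; exact_mod_cast hL k
  have hqk : ∀ k, 0 < ∑ t ∈ fiber idx k, q' t := fun k =>
    Finset.sum_pos (fun t _ => hq'0 t) (hne k)
  refine ⟨j, fun k => ∑ t ∈ fiber idx k, q' t, fun k _ => ⟨hqk k, ?_⟩, ?_, ?_⟩
  · rw [← hpQ k]
    exact Finset.sum_le_sum fun t _ => hq'p t
  · rw [← sum_block idx _ q', ← Finset.sum_congr rfl fun k _ => hpQ k, ← sum_block idx _ p,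
      ← hJ, hsplit q', hsplit p, Finset.sum_congr rfl hfst, Finset.sum_congr rfl hsnd,
      ← Finset.sum_div]
    rw [← Finset.mul_sum] at hbud
    linarith
  -- Concavity of the logarithm on a chunk, where `p` is constant, from `log u ≤ u - 1` with `u` the
  -- ratio of `q' t` to its chunk average.
  · have hjensen : ∀ k, ((fiber idx k).card : ℝ) * Real.log (Q k / ∑ t ∈ fiber idx k, q' t) ≤
        ∑ t ∈ fiber idx k, Real.log (p t / q' t) := by
      intro k
      set s := ∑ t ∈ fiber idx k, q' t with hs
      have hsp : 0 < s := hqk k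
      have h1 : ∀ t ∈ fiber idx k, Real.log (Q k / s) ≤
          Real.log (p t / q' t) + (q' t * ((fiber idx k).card / s) - 1) := by
        intro t ht
        have e : Q k / s = p t / q' t * (q' t * ((fiber idx k).card / s)) := by
          have := (hL k).ne'
          have := (hq'0 t).ne'
          simp only [hp, mem_fiber.1 ht]
          field_simp
        have h3 : 0 < q' t * ((fiber idx k).card / s) := by
          have := hL k
          have := hq'0 t
          positivity
        rw [e, Real.log_mul (div_pos (hp0 t) (hq'0 t)).ne' h3.ne']
        linarith [Real.log_le_sub_one_of_pos h3]
      have h2 := Finset.sum_le_sum h1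
      rw [Finset.sum_const, nsmul_eq_mul, Finset.sum_add_distrib, Finset.sum_sub_distrib,
        ← Finset.sum_mul, ← hs, mul_div_cancel₀ _ hsp.ne'] at h2
      simp at h2
      linarith
    refine (Finset.sum_le_sum fun k _ => hjensen k).trans ?_
    rw [← sum_block idx _ fun t => Real.log (p t / q' t), ← hJ, hsplit]
    refine add_le_add ?_ ?_
    · have e : ∑ t ∈ Finset.Iic m, Real.log (p t / q' t) =
          (∑ t ∈ Finset.Iic m, Real.logb 2 (p t / q t)) * Real.log 2 := by
        rw [Finset.sum_mul]
        refine Finset.sum_congr rfl fun t ht => ?_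
        rw [hfst t ht, Real.logb, div_mul_cancel₀ _ hl2.ne']
      rw [e]
      have h5 : ∑ t ∈ Finset.Iic m, Real.logb 2 (p t / q t) ≤ 2 * n * (R - 2 * ε) := by
        rw [one_div_mul_eq_div, div_lt_iff₀ (by positivity)] at h
        linarith
      gcongr
    · have e : ∑ t ∈ J \ Finset.Iic m, Real.log (p t / q' t) =
          ((J \ Finset.Iic m).card : ℝ) * Real.log 2 := by
        rw [← nsmul_eq_mul, ← Finset.sum_const]
        refine Finset.sum_congr rfl fun t ht => ?_
        rw [hsnd t ht]
        congr 1
        have := (hp0 t).ne'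
        field_simp
      rw [e]
      have hsub2 : J \ Finset.Iic m ⊆ fiber idx j := by
        intro t ht
        rw [Finset.mem_sdiff, hJ, mem_block, Finset.mem_Iic, Finset.mem_Iic, not_le] at ht
        exact mem_fiber.2 (le_antisymm ht.1 (hidx.mono ht.2.le))
      have : ((J \ Finset.Iic m).card : ℝ) ≤ 2 * n / K :=
        le_trans (by exact_mod_cast Finset.card_le_card hsub2) (hidx.card_le j)
      gcongr

/-- Without a jump, each new chunk multiplies the partial sum by at most five and adds `c`. -/
theorem sum_le_of_no_jump {K : ℕ} {B : Fin K → ℝ} {c : ℝ}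
    (h : ∀ i, B i ≤ 4 * ∑ k ∈ Finset.Iio i, B k + c) : ∑ k, B k ≤ (5 ^ K - 1) / 4 * c := by
  have key : ∀ m : ℕ, m ≤ K →
      ∑ k ∈ Finset.univ.filter (fun k : Fin K => (k : ℕ) < m), B k ≤ (5 ^ m - 1) / 4 * c := by
    intro m
    induction m with
    | zero => simp
    | succ m ih =>
      intro hm
      have e1 : Finset.univ.filter (fun k : Fin K => (k : ℕ) < m + 1) =
          insert ⟨m, hm⟩ (Finset.univ.filter fun k : Fin K => (k : ℕ) < m) := by
        ext k; simp [Fin.ext_iff]; omega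
      have e2 : Finset.Iio (⟨m, hm⟩ : Fin K) = Finset.univ.filter fun k : Fin K => (k : ℕ) < m := by
        ext k; simp [Fin.lt_def]
      rw [e1, Finset.sum_insert (by simp)]
      have h1 := h ⟨m, hm⟩
      rw [e2] at h1
      have h2 := ih (by omega)
      rw [pow_succ]
      linarith
  have := key K le_rfl
  rwa [Finset.filter_true_of_mem fun k _ => k.2] at this

theorem sum_Iic_add_sum_Ioi {K : ℕ} (j : Fin K) (f : Fin K → ℝ) :
    ∑ k ∈ Finset.Iic j, f k + ∑ k ∈ Finset.Ioi j, f k = ∑ k, f k := by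
  rw [← Finset.sum_add_sum_compl (Finset.Iic j) f]
  congr 2
  ext k; simp

theorem sum_Iio_add {K : ℕ} (j : Fin K) (f : Fin K → ℝ) :
    ∑ k ∈ Finset.Iio j, f k + f j = ∑ k ∈ Finset.Iic j, f k := by
  rw [← Finset.Iio_insert, Finset.sum_insert (by simp), add_comm]

theorem sum_card_fiber_le {n K : ℕ} (idx : Fin n → Fin K) (s : Finset (Fin K)) :
    ∑ k ∈ s, ((fiber idx k).card : ℝ) ≤ n := by
  have h := sum_univ_fiber idx fun _ => 1
  simp only [Finset.sum_const, Finset.card_univ, Fintype.card_fin, nsmul_eq_mul, mul_one] at h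
  rw [h]
  exact Finset.sum_le_sum_of_subset_of_nonneg (Finset.subset_univ _) fun _ _ _ => by positivity

/-- The smallness conditions on the auxiliary constants of the attack. -/
structure Tuning (P N ε d κ η δ : ℝ) (K : ℕ) : Prop where
  d_pos : 0 < d
  d_lt : d < 1
  log_le : Real.log (1 / (1 - d)) ≤ ε / 2 * Real.log 2
  le_chunks : 4 ≤ ε * K
  jump_pos : 0 < κ
  jump_eq : 5 ^ K * κ = P
  grid_pos : 0 < η
  grid_le : K * η ≤ d * P
  grid_le_jump : K * η ≤ d * κ / 8
  slack_le : δ ≤ d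
  slack_le_jump : δ * N ≤ d * κ / 16

/-- The attack against a code whose energy profile starts with a jump after a negligible amount
of energy. -/
theorem exists_attack_of_jump {n K : ℕ} {P N R ε d κ η δ : ℝ} (hn : 0 < n)
    (hε : 0 < ε) (hT : Tuning P N ε d κ η δ K) {idx : Fin n → Fin K}
    (hidx : IsChunking n K idx) {B : Fin K → ℝ} (hB : ∀ k, 0 < B k)
    (hBs : ∑ k, B k = n * (P + K * η)) (hR : 2 * ε < R) (hP : n * P / 2 ≤ n * N + n * κ / 8) :
    ∃ (j : Fin K) (α : Fin K → ℝ), (∀ k ≤ j, 0 < α k ∧ α k < 1) ∧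
      ∑ k ∈ Finset.Iic j, α k * B k + (∑ k ∈ Finset.Ioi j, B k) / 2 ≤ (1 - δ) * (n * N) ∧
      ∑ k ∈ Finset.Iic j, ((fiber idx k).card : ℝ) * Real.log (1 / α k) ≤
        2 * n * (R - ε) * Real.log 2 := by
  obtain ⟨hd, hd1, hlog, hKε, hκ, hκP, hη, hηP, hηκ, hδd, hδκ⟩ := hT
  have hl2 : 0 < Real.log 2 := Real.log_pos one_lt_two
  have hn' : (0 : ℝ) < n := by exact_mod_cast hn
  have hK : (0 : ℝ) < K := by
    by_contra hcon
    nlinarith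
  -- Otherwise the total energy would be at most `5 ^ K * κ * n = n P`, less than its actual value.
  have hjump : ∃ i, 4 * ∑ k ∈ Finset.Iio i, B k + κ * n ≤ B i := by
    by_contra hcon
    push Not at hcon
    have h1 := sum_le_of_no_jump fun i => (hcon i).le
    rw [hBs] at h1
    have h2 : (5 ^ K - 1) / 4 * (κ * n) ≤ 5 ^ K * κ * n := by
      have : (0 : ℝ) < 5 ^ K := by positivity
      have : 0 < κ * n := by positivity
      nlinarith
    rw [hκP] at h2
    have : 0 < n * (K * η) := by positivity
    nlinarith
  obtain ⟨i, hi⟩ := hjump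
  set pre := ∑ k ∈ Finset.Iio i, B k with hpre
  have hpre0 : 0 ≤ pre := Finset.sum_nonneg fun k _ => (hB k).le
  have hκη : K * η ≤ κ / 8 := by nlinarith
  have hδκ' : δ * N ≤ κ / 16 := by nlinarith
  -- Strength `1 - d` before the jump leaks almost nothing. Strength `1 / 4` on the jump chunk saves
  -- `B i / 4` compared with pushing, which outweighs the prefix cost by `κ n / 4`; its leakage is
  -- small because the chunk is short.
  refine ⟨i, fun k => if k = i then 1 / 4 else 1 - d, fun k _ => ?_, ?_, ?_⟩
  · dsimp only
    split_ifs
    · norm_num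
    · constructor <;> linarith
  · have e1 : ∑ k ∈ Finset.Iio i, (if k = i then 1 / 4 else 1 - d) * B k = (1 - d) * pre := by
      rw [hpre, Finset.mul_sum]
      refine Finset.sum_congr rfl fun k hk => ?_
      rw [if_neg (Finset.mem_Iio.1 hk).ne]
    have e2 := sum_Iic_add_sum_Ioi i B
    have e3 := sum_Iio_add i B
    rw [← sum_Iio_add]
    beta_reduce
    rw [e1, if_pos rfl]
    rw [hBs, ← e3] at e2
    have h1 : n * (K * η) ≤ n * (κ / 8) := by gcongr
    have h2 : n * (δ * N) ≤ n * (κ / 16) := by gcongr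
    have := mul_nonneg hd.le hpre0
    linarith
  · have e1 : ∑ k ∈ Finset.Iio i, ((fiber idx k).card : ℝ) *
        Real.log (1 / (if k = i then 1 / 4 else 1 - d)) ≤ n * Real.log (1 / (1 - d)) := by
      have : 0 ≤ Real.log (1 / (1 - d)) := by
        refine Real.log_nonneg ?_
        rw [le_div_iff₀ (by linarith)]; linarith
      refine le_trans (le_of_eq ?_)
        (mul_le_mul_of_nonneg_right (sum_card_fiber_le idx (Finset.Iio i)) this)
      rw [Finset.sum_mul]
      refine Finset.sum_congr rfl fun k hk => ?_
      rw [if_neg (Finset.mem_Iio.1 hk).ne]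
    have e2 : Real.log (1 / (1 / 4)) = 2 * Real.log 2 := by
      rw [one_div_one_div, show (4 : ℝ) = 2 ^ 2 by norm_num, Real.log_pow]; norm_num
    rw [← sum_Iio_add]
    beta_reduce
    rw [if_pos rfl, e2]
    have h1 : ((fiber idx i).card : ℝ) ≤ n * (ε / 2) := by
      refine (hidx.card_le i).trans ?_
      rw [div_le_iff₀ hK]
      nlinarith
    have h2 : ((fiber idx i).card : ℝ) * (2 * Real.log 2) ≤ n * (ε / 2) * (2 * Real.log 2) := by
      gcongr
    have h3 : n * Real.log (1 / (1 - d)) ≤ n * (ε / 2 * Real.log 2) := by gcongr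
    have h4 : 2 * n * ε * Real.log 2 ≤ 2 * n * (R - ε) * Real.log 2 := by
      gcongr
      linarith
    have h5 : 0 < n * ε * Real.log 2 := by positivity
    linarith

/-- A power allocation close to the energy profile `B`, with the excess moved to the last chunk. -/
theorem exists_allocation {n K : ℕ} {P d η : ℝ} (hd1 : d < 1)
    {B : Fin K → ℝ} (hB : ∀ k, 0 < B k) (hBs : ∑ k, B k = n * (P + K * η)) (last : Fin K)
    (hslack : 0 ≤ d * P - (1 - d) * (K * η)) :
    ∃ Q : Fin K → ℝ, (∀ k, 0 < Q k) ∧ (∀ k, (1 - d) * B k ≤ Q k) ∧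
      (∀ k, k ≠ last → Q k = (1 - d) * B k) ∧ ∑ k, Q k = n * P := by
  have hd' : 0 < 1 - d := by linarith
  let Q : Fin K → ℝ := fun k => if k = last then B last * (1 - d) + n * (d * P - (1 - d) * (K * η))
    else (1 - d) * B k
  have hQB : ∀ k, (1 - d) * B k ≤ Q k := fun k => by
    simp only [Q]
    split_ifs with h
    · have : 0 ≤ n * (d * P - (1 - d) * (K * η)) := by positivity
      rw [h]; linarith
    · exact le_rfl
  have hQlt : ∀ k, k ≠ last → Q k = (1 - d) * B k := fun k hk => if_neg hk
  refine ⟨Q, fun k => (mul_pos hd' (hB k)).trans_le (hQB k), hQB, hQlt, ?_⟩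
  have h1 : ∑ k, (Q k - (1 - d) * B k) = n * (d * P - (1 - d) * (K * η)) := by
    rw [Finset.sum_eq_single last]
    · simp only [Q, if_true]; ring
    · intro k _ hk
      rw [hQlt k hk, sub_self]
    · simp
  rw [Finset.sum_sub_distrib, ← Finset.mul_sum, hBs] at h1
  linarith

theorem mem_signalPowers_of_chunks {n K : ℕ} {P : ℝ} {idx : Fin n → Fin K}
    (hL : ∀ k, (0 : ℝ) < (fiber idx k).card) {Q : Fin K → ℝ} (hQ : ∀ k, 0 < Q k)
    (hQs : ∑ k, Q k = n * P) :
    (fun t => Q (idx t) / (fiber idx (idx t)).card) ∈ signalPowers n P := by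
  refine ⟨fun t => div_pos (hQ _) (hL _), ?_⟩
  rw [sum_univ_fiber idx, ← hQs]
  refine Finset.sum_congr rfl fun k _ => ?_
  have : ∀ t ∈ fiber idx k, Q (idx t) / (fiber idx (idx t)).card = Q k / (fiber idx k).card :=
    fun t ht => by rw [mem_fiber.1 ht]
  rw [Finset.sum_congr rfl this, Finset.sum_const, nsmul_eq_mul]
  have := (hL k).ne'
  field_simp

/-- The energy of babbling at the level `(1 - d) ^ 2 * (q / Q)`. -/
theorem sum_babble_le {K : ℕ} {d : ℝ} (hd : d < 1) {B Q q : Fin K → ℝ} {s : Finset (Fin K)}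
    (hQ : ∀ k, 0 < Q k) (hQB : ∀ k, (1 - d) * B k ≤ Q k) (hq : ∀ k ∈ s, 0 < q k) :
    ∑ k ∈ s, (1 - d) ^ 2 * (q k / Q k) * B k ≤ (1 - d) * ∑ k ∈ s, q k := by
  have hd' : 0 < 1 - d := by linarith
  rw [Finset.mul_sum]
  refine Finset.sum_le_sum fun k hk => ?_
  have h2 := hq k hk
  have h3 := hQ k
  calc (1 - d) ^ 2 * (q k / Q k) * B k = (1 - d) * (q k / Q k) * ((1 - d) * B k) := by ring
    _ ≤ (1 - d) * (q k / Q k) * Q k := by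
        gcongr
        exact hQB k
    _ = (1 - d) * q k := by field_simp

/-- The information leaked by babbling at the level `(1 - d) ^ 2 * (q / Q)`. -/
theorem sum_log_babble_le {n K : ℕ} {P N R ε d κ η δ : ℝ} (hn : 0 < n) (hε : 0 < ε)
    (hT : Tuning P N ε d κ η δ K) (hK : 0 < K) (idx : Fin n → Fin K) {Q q : Fin K → ℝ}
    {s : Finset (Fin K)} (hQ : ∀ k, 0 < Q k) (hq : ∀ k ∈ s, 0 < q k)
    (hinfo : ∑ k ∈ s, ((fiber idx k).card : ℝ) * Real.log (Q k / q k) ≤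
      2 * n * (R - 2 * ε) * Real.log 2 + 2 * n / K * Real.log 2) :
    ∑ k ∈ s, ((fiber idx k).card : ℝ) * Real.log (1 / ((1 - d) ^ 2 * (q k / Q k))) ≤
      2 * n * (R - ε) * Real.log 2 := by
  have hd1 := hT.d_lt
  have hd' : 0 < 1 - d := by linarith
  have hlog := hT.log_le
  have hKε := hT.le_chunks
  have hl2 : 0 < Real.log 2 := Real.log_pos one_lt_two
  have hn' : (0 : ℝ) < n := by exact_mod_cast hn
  have hK0 : (0 : ℝ) < K := by exact_mod_cast hK
  have hlog0 : 0 ≤ Real.log (1 / (1 - d)) := by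
    refine Real.log_nonneg ?_
    rw [le_div_iff₀ hd']; linarith [hT.d_pos]
  have e1 : ∀ k ∈ s, ((fiber idx k).card : ℝ) *
      Real.log (1 / ((1 - d) ^ 2 * (q k / Q k))) =
      (fiber idx k).card * Real.log (Q k / q k) +
        (fiber idx k).card * (2 * Real.log (1 / (1 - d))) := by
    intro k hk
    have h1 := hq k hk
    have h2 := hQ k
    have e : 1 / ((1 - d) ^ 2 * (q k / Q k)) = (Q k / q k) * (1 / (1 - d)) ^ 2 := by
      field_simp
    rw [e, Real.log_mul (by positivity) (by positivity), Real.log_pow]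
    push_cast
    ring
  rw [Finset.sum_congr rfl e1, Finset.sum_add_distrib, ← Finset.sum_mul]
  have h1 : (∑ k ∈ s, ((fiber idx k).card : ℝ)) * (2 * Real.log (1 / (1 - d))) ≤
      n * (2 * (ε / 2 * Real.log 2)) :=
    mul_le_mul (sum_card_fiber_le idx s) (by linarith) (by linarith) hn'.le
  have h2 : 2 * n / K * Real.log 2 ≤ n * (ε / 2) * Real.log 2 := by
    refine mul_le_mul_of_nonneg_right ?_ hl2.le
    rw [div_le_iff₀ hK0]
    have := mul_le_mul_of_nonneg_left hKε hn'.le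
    linarith
  have h3 : 0 < n * ε * Real.log 2 := by positivity
  linarith

/-- The babble-and-push attack extracted from the optimization. -/
theorem exists_chunk_attack {n K : ℕ} {P N R ε d κ η δ : ℝ} (hn : 0 < n) (hN : 0 < N)
    (hε : 0 < ε) (hT : Tuning P N ε d κ η δ K) {idx : Fin n → Fin K}
    {last : Fin K} (hlast : ∀ k, k ≤ last)
    (hidx : IsChunking n K idx) {B : Fin K → ℝ} (hB : ∀ k, 0 < B k)
    (hBs : ∑ k, B k = n * (P + K * η))
    (hR : optValue n P N + ((3 * ε : ℝ) : EReal) ≤ (R : EReal)) :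
    2 * ε < R ∧ ∃ (j : Fin K) (α : Fin K → ℝ), (∀ k ≤ j, 0 < α k ∧ α k < 1) ∧
      ∑ k ∈ Finset.Iic j, α k * B k + (∑ k ∈ Finset.Ioi j, B k) / 2 ≤ (1 - δ) * (n * N) ∧
      ∑ k ∈ Finset.Iic j, ((fiber idx k).card : ℝ) * Real.log (1 / α k) ≤
        2 * n * (R - ε) * Real.log 2 := by
  have hT' := hT
  obtain ⟨hd, hd1, hlog, hKε, hκ, hκP, hη, hηP, hηκ, hδd, hδκ⟩ := hT
  have hn' : (0 : ℝ) < n := by exact_mod_cast hn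
  have hK : 0 < K := last.pos
  have hK0 : (0 : ℝ) < K := by exact_mod_cast hK
  have hL : ∀ k, (0 : ℝ) < (fiber idx k).card := fun k =>
    lt_of_lt_of_le (by positivity) (hidx.le_card k)
  have hd' : 0 < 1 - d := by linarith
  have hslack : 0 ≤ d * P - (1 - d) * (K * η) := by
    have : 0 < K * η := by positivity
    nlinarith
  obtain ⟨Q, hQ0, hQB, hQlt, hQs⟩ := exists_allocation hd1 hB hBs last hslack
  obtain ⟨a, ha, hval⟩ := exists_feasible_lt hε (mem_signalPowers_of_chunks hL hQ0 hQs) hR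
  have hR2 : 2 * ε < R := lt_of_feasible_lt ha hval
  refine ⟨hR2, ?_⟩
  obtain ⟨j, q, hq, hbud, hinfo⟩ := exists_chunk_noise hn hidx hQ0 ha hval
  have hqj : ∀ k ∈ Finset.Iic j, 0 < q k := fun k hk => (hq k (Finset.mem_Iic.1 hk)).1
  have hq0 : 0 ≤ ∑ k ∈ Finset.Iic j, q k := Finset.sum_nonneg fun k hk => (hqj k hk).le
  have hBj := sum_Iic_add_sum_Ioi j B
  have hQj : j ≠ last → ∑ k ∈ Finset.Iic j, Q k = (1 - d) * ∑ k ∈ Finset.Iic j, B k := by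
    intro hj
    rw [Finset.mul_sum]
    refine Finset.sum_congr rfl fun k hk => hQlt k fun h => ?_
    exact hj (le_antisymm (hlast j) (h ▸ Finset.mem_Iic.1 hk))
  have hSB0 : 0 ≤ ∑ k ∈ Finset.Iic j, B k := Finset.sum_nonneg fun k _ => (hB k).le
  -- With little prefix energy, `hbud` says that pushing from the start exceeds the budget by at
  -- most `n κ / 8`, the regime of the jump attack.
  by_cases hcase : j ≠ last ∧ ∑ k ∈ Finset.Iic j, B k < κ / 4 * n
  · obtain ⟨hj, hsmall⟩ := hcase
    refine exists_attack_of_jump hn hε hT' hidx hB hBs hR2 ?_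
    rw [hQj hj] at hbud
    have := mul_nonneg hd.le hSB0
    linarith
  -- One factor `1 - d` offsets that `B` may exceed `Q`; the other lowers the babble energy and
  -- keeps the strength below one.
  refine ⟨j, fun k => (1 - d) ^ 2 * (q k / Q k), fun k hk => ?_, ?_,
    sum_log_babble_le hn hε hT' hK idx hQ0 hqj hinfo⟩
  · have h1 := hq k hk
    have h2 : q k / Q k ≤ 1 := (div_le_one (hQ0 k)).2 h1.2
    have h3 : 0 < q k / Q k := div_pos h1.1 (hQ0 k)
    refine ⟨by positivity, ?_⟩
    have h4 : (1 - d) ^ 2 < 1 := by nlinarith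
    nlinarith
  · refine (add_le_add_left (sum_babble_le hd1 hQ0 hQB hqj) _).trans ?_
    by_cases hj : j = last
    · have e1 : Finset.Ioi j = ∅ := by
        rw [hj]; ext k; simp [hlast]
      have e2 : Finset.Iic j = Finset.univ := by
        rw [hj]; ext k; simp [hlast]
      rw [e2, hQs] at hbud
      rw [e1, e2]
      simp only [Finset.sum_empty, zero_div, add_zero]
      have h2 : ∑ k, q k ≤ n * N := by linarith
      have h3 : (1 - d) * ∑ k, q k ≤ (1 - d) * (n * N) := by gcongr
      have h4 : (1 - d) * (n * N) ≤ (1 - δ) * (n * N) := by gcongr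
      linarith
    -- Replacing `Q` by `B` on the prefix frees at least `d κ n / 8` of push energy. The grid excess
    -- takes at most half, and the other half covers `δ n N`.
    · have hbig : κ / 4 * n ≤ ∑ k ∈ Finset.Iic j, B k := by
        by_contra hcon
        exact hcase ⟨hj, not_le.1 hcon⟩
      rw [hQj hj] at hbud
      rw [hBs] at hBj
      have h2 : n * (K * η) ≤ n * (d * κ / 8) := mul_le_mul_of_nonneg_left hηκ hn'.le
      have h3 : n * (δ * N) ≤ n * (d * κ / 16) := mul_le_mul_of_nonneg_left hδκ hn'.le
      have h4 := mul_le_mul_of_nonneg_left hbig hd.le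
      have h5 := mul_nonneg hd.le hq0
      linarith

/-! ### Choice of the constants and conclusion -/

theorem exists_tuning {P N ε : ℝ} (hP : 0 < P) (hN : 0 < N) (hε : 0 < ε) :
    ∃ (d κ η δ : ℝ) (K : ℕ), 0 < K ∧ 0 < δ ∧ Tuning P N ε d κ η δ K := by
  have hl2 : 0 < Real.log 2 := Real.log_pos one_lt_two
  obtain ⟨K, hK⟩ := exists_nat_ge (4 / ε)
  rw [div_le_iff₀ hε] at hK
  have hK0 : (0 : ℝ) < K := by
    by_contra hcon
    nlinarith
  set d : ℝ := 1 - Real.exp (-(ε / 2 * Real.log 2)) with hd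
  have hd0 : 0 < d := by
    have : Real.exp (-(ε / 2 * Real.log 2)) < 1 := by
      rw [← Real.exp_zero, Real.exp_lt_exp]
      have : 0 < ε / 2 * Real.log 2 := by positivity
      linarith
    linarith
  have hd1 : d < 1 := by linarith [Real.exp_pos (-(ε / 2 * Real.log 2))]
  set κ := P / 5 ^ K with hκ
  have hκ0 : 0 < κ := by positivity
  refine ⟨d, κ, min (d * P) (d * κ / 8) / K, min d (d * κ / (16 * N)), K,
    by exact_mod_cast hK0, by positivity, hd0, hd1, ?_, by linarith, hκ0, ?_, by positivity,
    ?_, ?_, min_le_left _ _, ?_⟩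
  · rw [hd, sub_sub_cancel, Real.log_div one_ne_zero (Real.exp_pos _).ne', Real.log_exp]
    simp
  · rw [hκ]; field_simp
  · rw [mul_div_cancel₀ _ hK0.ne']; exact min_le_left _ _
  · rw [mul_div_cancel₀ _ hK0.ne']; exact min_le_right _ _
  · calc min d (d * κ / (16 * N)) * N ≤ d * κ / (16 * N) * N := by
          gcongr; exact min_le_right _ _
      _ = d * κ / 16 := by field_simp

/-- Needed before any code is examined: a positive rate excludes `M = 0`, on which the pigeonhole
argument depends. A flat profile suffices. -/
theorem two_mul_lt_rate {n K : ℕ} {P N R ε d κ η δ : ℝ} (hn : 0 < n) (hP : 0 < P) (hN : 0 < N)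
    (hε : 0 < ε) (hT : Tuning P N ε d κ η δ K) {idx : Fin n → Fin K} {last : Fin K}
    (hlast : ∀ k, k ≤ last) (hidx : IsChunking n K idx)
    (hR : optValue n P N + ((3 * ε : ℝ) : EReal) ≤ (R : EReal)) : 2 * ε < R := by
  have hK : (0 : ℝ) < K := by exact_mod_cast last.pos
  have hη := hT.grid_pos
  refine (exists_chunk_attack hn hN hε hT hlast hidx (B := fun _ => n * (P + K * η) / K)
    (fun _ => by positivity) ?_ hR).1
  rw [Finset.sum_const, Finset.card_univ, Fintype.card_fin, nsmul_eq_mul]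
  field_simp

/-- A sufficiently massive set of codewords with a common energy profile of total energy
`n * (P + K * η)`. -/
theorem exists_profile {M n K : ℕ} {P η : ℝ} (C : Code M n P) (hM : M ≠ 0) (hn : 0 < n)
    (hη : 0 < η) (idx : Fin n → Fin K) (last : Fin K) :
    ∃ B : Fin K → ℝ, (∀ k, 0 < B k) ∧ ∑ k, B k = n * (P + K * η) ∧
      ENNReal.ofReal (1 / (⌊P / η⌋₊ + 1) ^ K) ≤
        messageLaw C (Set.univ ×ˢ chunkBall idx B) := by
  obtain ⟨B, hB, hBs, hBm⟩ := exists_chunkBall_mass C hM hn hη idx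
  -- The unused energy goes to the last chunk, which only enlarges the set of codewords and makes
  -- the total exact.
  have hle : ∀ k, B k ≤ B k + if k = last then n * (P + K * η) - ∑ k, B k else 0 := by
    intro k
    split_ifs <;> linarith
  refine ⟨fun k => B k + if k = last then n * (P + K * η) - ∑ k, B k else 0,
    fun k => (hB k).trans_le (hle k), ?_, hBm.trans (measure_mono (Set.prod_mono le_rfl
      fun x hx k => (hx k).trans (hle k)))⟩
  rw [Finset.sum_add_distrib, Finset.sum_ite_eq' Finset.univ last]
  simp

end QuadCausal

end

theorem theorem1 (P N : ℝ) (hP : 0 < P) (hN : 0 < N) (ε : ℝ) (hε : 0 < ε) :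
    ∃ c : ℝ, 0 < c ∧ ∃ n₀ : ℕ, ∀ n : ℕ, n₀ ≤ n → ∀ (M : ℕ) (C : QuadCausal.Code M n P),
      QuadCausal.optValue n P N + ((3 * ε : ℝ) : EReal) ≤ ((QuadCausal.rate M n : ℝ) : EReal) →
        ENNReal.ofReal (c * ε) ≤ QuadCausal.avgError N C := by
  open QuadCausal in
  obtain ⟨d, κ, η, δ, K, hK, hδ, hT⟩ := exists_tuning hP hN hε
  have hη := hT.grid_pos
  have hK' : (0 : ℝ) < K := by exact_mod_cast hK
  set g : ℝ := 1 / (⌊P / η⌋₊ + 1) ^ K with hg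
  have hg0 : 0 < g := by positivity
  -- The bound `4 K P` on the power per symbol: a chunk has energy at most `2 n P` and length at
  -- least `n / (2 K)`.
  obtain ⟨n₀, hn₀⟩ := exists_avgError_ge_of_attack (A := 4 * K * P) hP.le hN (by positivity) hδ
    hε hg0
  refine ⟨g * δ / (16 * ε), by positivity, max n₀ (2 * K), fun n hn M C hR => ?_⟩
  have hnK : 2 * K ≤ n := (le_max_right _ _).trans hn
  have hn0 : 0 < n := by omega
  have hn' : (0 : ℝ) < n := by exact_mod_cast hn0
  obtain ⟨idx, hidx⟩ := exists_isChunking hK hnK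
  let last : Fin K := ⟨K - 1, by omega⟩
  have hlast : ∀ k, k ≤ last := fun k => Fin.le_def.2 (Nat.le_sub_one_of_lt k.2)
  have hR2 := two_mul_lt_rate hn0 hP hN hε hT hlast hidx hR
  have hM : M ≠ 0 := ne_zero_of_rate_pos (by linarith)
  obtain ⟨B, hB, hBs, hBm⟩ := exists_profile C hM hn0 hη idx last
  obtain ⟨-, j, α, hα, hbud, hinfo⟩ := exists_chunk_attack hn0 hN hε hT hlast hidx hB hBs hR
  have hBA : ∀ k, B k / (fiber idx k).card ≤ 4 * K * P := by
    intro k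
    have h1 := hidx.le_card k
    have hL : (0 : ℝ) < (fiber idx k).card := lt_of_lt_of_le (by positivity) h1
    have h2 : B k ≤ n * (P + K * η) := by
      rw [← hBs]
      exact Finset.single_le_sum (fun i _ => (hB i).le) (Finset.mem_univ k)
    have h3 : K * η ≤ P := by nlinarith [hT.grid_le, hT.d_lt]
    have h4 : n * (P + K * η) ≤ n * (P + P) := by gcongr
    rw [div_le_iff₀ hL]
    calc B k ≤ n * (P + P) := h2.trans h4
      _ = 4 * K * P * (n / (2 * K)) := by field_simp; ring
      _ ≤ _ := by gcongr
  have key := hn₀ n ((le_max_left _ _).trans hn) M C _ _ _ _ _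
    (isAttack_of_chunks hn0 hidx hB hBA j hα hbud) hM hBm (by
      rw [← Finset.sum_div, sum_block_comp idx _ fun k => Real.log (1 / α k)]
      simp only [mul_comm (Real.log _) ((Finset.card _ : ℕ) : ℝ)]
      linarith)
  rwa [show g * δ / (16 * ε) * ε = g * δ / 16 by field_simp]
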